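/- There is an absolute constant $C>0$ such that the following holds. Let $K\subset\mathbb R^n$ be a symmetric convex body (compact, convex, with nonempty interior, $K=-K$), where $\mathbb R^n$ carries a Euclidean structure $\langle\cdot,\cdot\rangle$ with norm $|\cdot|_2$ and unit ball $B_2^n$. Let $\|\cdot\|_K$ be the norm with unit ball $K$, and let $D$ be the radius of $K$, i.e. the smallest $D$ with $K\subset D B_2^n$. Let $q\ge 2$, let $q^*$ be its conjugate exponent ($1/q+1/q^*=1$), and assume that $K$ has modulus of convexity of power type $q$ with constant $\lambda>0$, that is, $$\Big\|\frac{x+y}2\Big\|_K^q+\lambda^{-q}\Big\|\frac{x-y}2\Big\|_K^q\le\frac12\big(\|x\|_K^q+\|y\|_K^q\big)\qquad\text{for all }x,y\in\mathbb R^n .$$ Let $p\ge q$, let $m\ge 2$, let $X$ be a random vector in $\mathbb R^n$ with $\mathbb E|\langle X,y\rangle|^p<\infty$ for all $y\in K$, and let $X_1,\dots,X_m$ be independent copies of $X$. Put $$\kappa_{p,m}(X)=\Big(\mathbb E\max_{1\le j\le m}|X_j|_2^p\Big)^{1/p},\quad A=C^p\lambda^p\,\frac{(\log m)^{1/q^*}}{\sqrt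 m}\,\big(D\,\kappa_{p,m}(X)\big)^{p/2},\quad B=\sup_{y\in K}\mathbb E|\langle X,y\rangle|^p,$$ $$V_p(K)=\sup_{y\in K}\Big|\frac1m\sum_{j=1}^m|\langle X_j,y\rangle|^p-\mathbb E|\langle X,y\rangle|^p\Big| .$$ Then $\kappa_{p,m}(X)$, $B$, $V_p(K)$ and $\mathbb E V_p(K)$ are finite, and $$\mathbb E\,V_p(K)\le A^2+A\sqrt B .$$ Consequently, if $A^2\le\delta^2B$ for some $0\le\delta<1$, then $\mathbb E\,V_p(K)\le 2\delta B$. -/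

import Mathlib

open MeasureTheory ProbabilityTheory

/-- `K` is a symmetric convex body: a compact convex set with nonempty interior and `K = -K`. -/
structure IsSymmConvexBody {E : Type*} [NormedAddCommGroup E] [NormedSpace ℝ E]
    (K : Set E) : Prop where
  convex : Convex ℝ K
  isCompact : IsCompact K
  nonempty_interior : (interior K).Nonempty
  neg_mem : ∀ x ∈ K, -x ∈ K

/-- `K` has modulus of convexity of power type `q` with constant `lam`. Here `gauge K` is the norm
whose unit ball is `K`. -/
def HasPowerTypeConvexity {E : Type*} [NormedAddCommGroup E] [NormedSpace ℝ E]
    (K : Set E) (q lam : ℝ) : Prop :=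
  ∀ x y : E,
    gauge K ((1 / 2 : ℝ) • (x + y)) ^ q + lam ^ (-q) * gauge K ((1 / 2 : ℝ) • (x - y)) ^ q
      ≤ (1 / 2) * (gauge K x ^ q + gauge K y ^ q)

/-- `D` is the radius of `K`: the smallest `D` with `K ⊆ D B`, where `B` is the Euclidean unit
ball. -/
def IsRadius {E : Type*} [NormedAddCommGroup E] (K : Set E) (D : ℝ) : Prop :=
  IsLeast {R : ℝ | K ⊆ Metric.closedBall (0 : E) R} D

/-- The exact `p`-moment `𝔼 |⟨X, y⟩| ^ p` of `X` in direction `y`. -/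
noncomputable def exactMoment {Ω E : Type*} [MeasurableSpace Ω] [NormedAddCommGroup E]
    [InnerProductSpace ℝ E] (P : Measure Ω) (X : Ω → E) (p : ℝ) (y : E) : ℝ :=
  ∫ ω, |inner ℝ (X ω) y| ^ p ∂P

/-- The deviation in direction `y` of the empirical `p`-moment of the sample `Xs` from the exact
`p`-moment of `X`. -/
noncomputable def momentDeviation {Ω E : Type*} [MeasurableSpace Ω] [NormedAddCommGroup E]
    [InnerProductSpace ℝ E] (P : Measure Ω) (X : Ω → E) {m : ℕ} (Xs : Fin m → Ω → E) (p : ℝ)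
    (ω : Ω) (y : E) : ℝ :=
  |(1 / (m : ℝ)) * ∑ j, |inner ℝ (Xs j ω) y| ^ p - exactMoment P X p y|

/-- The maximal deviation `V_p(K)`. -/
noncomputable def maxMomentDeviation {Ω E : Type*} [MeasurableSpace Ω] [NormedAddCommGroup E]
    [InnerProductSpace ℝ E] (P : Measure Ω) (K : Set E) (X : Ω → E) {m : ℕ}
    (Xs : Fin m → Ω → E) (p : ℝ) (ω : Ω) : ℝ :=
  ⨆ y : K, momentDeviation P X Xs p ω (y : E)

/-- The parameter `κ_{p,m}(X) = (𝔼 max_j |X_j| ^ p) ^ (1/p)`. -/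
noncomputable def kappa {Ω E : Type*} [MeasurableSpace Ω] [NormedAddCommGroup E]
    (P : Measure Ω) {m : ℕ} (Xs : Fin m → Ω → E) (p : ℝ) : ℝ :=
  (∫ ω, (⨆ j, ‖Xs j ω‖ ^ p) ∂P) ^ (1 / p)

/-- `A = C^p lam^p (log m)^{1/q'} m^{-1/2} (D κ_{p,m}(X))^{p/2}`, where `q'` is the conjugate
exponent of `q`. -/
noncomputable def deviationA {Ω E : Type*} [MeasurableSpace Ω] [NormedAddCommGroup E]
    (P : Measure Ω) {m : ℕ} (Xs : Fin m → Ω → E) (C lam D p q' : ℝ) : ℝ :=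
  C ^ p * lam ^ p * (Real.log m ^ (1 / q') / Real.sqrt m) * (D * kappa P Xs p) ^ (p / 2)

/-- `B = sup_{y ∈ K} 𝔼 |⟨X, y⟩| ^ p`. -/
noncomputable def momentB {Ω E : Type*} [MeasurableSpace Ω] [NormedAddCommGroup E]
    [InnerProductSpace ℝ E] (P : Measure Ω) (K : Set E) (X : Ω → E) (p : ℝ) : ℝ :=
  ⨆ y : K, exactMoment P X p (y : E)

/-!
The argument is the symmetrization method, with the Rademacher process
`y ↦ ∑ j, ε j * |⟨x j, y⟩| ^ p` on `K` bounded, for fixed vectors `x j`, by generic chaining.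

*Metric.* The increments of the process are dominated by the distances of the points
`powerMap p x y`, whose coordinates are the signed powers of `⟨x j, y⟩`. Since the signed power is
monotone, the midpoint of `u` and `v` is never farther from `u` than `v` is.

*Chaining.* `ChainBound` is a chaining functional over finitely many scales `n`, with `2 ^ 4 ^ (n+1)`
cells and weight `2 ^ n` at scale `n`; scales with `4 ^ n > m` are irrelevant
(`ChainBound.rademacher`). It is estimated by a contraction principle
(`ChainBound.of_contraction`): it suffices that every set `A` can be cut, at each scale, into pieces
of diameter `diam A / 4 + sup_A s n`, where `∑ n, 2 ^ n * s n` is bounded.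

*Convexity.* To cut `A`, each of its points `y` is moved to the minimizer `π n y` of
`gauge K ^ q + t * dist y ·` with `t` proportional to `2 ^ n`. The displacements, weighted by
`2 ^ n`, have a bounded sum (`sum_dist_penalized_le`), and by power type convexity the minimizers
lie within `ρ ≈ λ * (t * diam A) ^ (1 / q)` of each other in the norm of `K`
(`HasPowerTypeConvexity.gauge_sub_le`).

*Entropy.* Near a point `u` the metric is controlled by the Euclidean norm with weights
`|⟨x j, u⟩| ^ (p - 1)` and by the maximum norm `max_j |⟨x j, ·⟩|`. Euclidean balls are covered in
both norms by comparing Gaussian measures of translates (`exists_cover_weighted_and_max`); only the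
maximum norm costs a factor `√(log m)`. This yields pieces of diameter of order
`2 ^ (-n) * (ρ + ρ ^ p * √(log m))` (`exists_cover_powerMap`). As `p ≥ q`, the second term is linear
in `diam A`, and Young's inequality `t ^ (1 / q) ≤ l ^ (1 - 1 / q) * (t + 1 / l)` with `l ≈ log m`
makes the first one linear in `diam A` up to an error that sums to the order of
`(log m) ^ (1 - 1 / q)` over the `O(log m)` scales (`chainBound_powerMap`).

*Conclusion.* Integrating over the sample and using the Cauchy-Schwarz inequality gives
`v ≤ A * √(v + B)` for the expected deviation `v` (`integral_sampleDeviation_le`), which is a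
quadratic inequality for `v`.
-/

/-! ### Multiscale partitions -/

/-- `ChainBound F N Γ`: the truncated generic chaining functional of the index set `T`, for the
pseudometric `dist (F x) (F y)`, is at most `Γ`. At scale `n` the set `T` is cut into at most
`2 ^ 4 ^ (n + 1)` cells `c n ⁻¹' {i}` of diameter at most `δ n i`, the cell at scale `0` being `T`
itself; with sizes growing like `2 ^ 4 ^ n` the weight of scale `n` is `2 ^ n`. -/
def ChainBound {T V : Type*} [PseudoMetricSpace V] (F : T → V) (N : ℕ) (Γ : ℝ) : Prop :=
  ∃ (ι : ℕ → Type) (_ : ∀ n, Fintype (ι n)) (c : ∀ n, T → ι n) (δ : ∀ n, ι n → ℝ),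
    Subsingleton (ι 0) ∧ (∀ n, Fintype.card (ι n) ≤ 2 ^ 4 ^ (n + 1)) ∧
    (∀ n ≤ N, ∀ x y, c n x = c n y → dist (F x) (F y) ≤ δ n (c n x)) ∧
    ∀ x, ∑ n ∈ Finset.range (N + 1), 2 ^ n * δ n (c n x) ≤ Γ

section Contraction

variable {T V : Type*} [PseudoMetricSpace V] {F : T → V} {N : ℕ} {Γ : ℝ}

theorem ChainBound.mono {Γ' : ℝ} (h : ChainBound F N Γ) (hΓ : Γ ≤ Γ') : ChainBound F N Γ' := by
  obtain ⟨ι, hι, c, δ, h0, h1, h2, h3⟩ := h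
  exact ⟨ι, hι, c, δ, h0, h1, h2, fun x => (h3 x).trans hΓ⟩

theorem ChainBound.of_diam {Δ₀ : ℝ} (hΔ : ∀ x y, dist (F x) (F y) ≤ Δ₀) :
    ChainBound F N (∑ n ∈ Finset.range (N + 1), 2 ^ n * Δ₀) :=
  ⟨fun _ => Unit, fun _ => inferInstance, fun _ _ => (), fun _ _ => Δ₀, inferInstance,
    fun n => by simpa using Nat.one_le_two_pow, fun _ _ x y _ => hΔ x y, fun _ => le_rfl⟩

/-- One step of the contraction principle. If every cell `A` at scale `n` can be cut into
`2 ^ 4 ^ (n + 1)` pieces of diameter `a * diam A + sup_A s n`, then the cells of a given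
partition, cut first according to the approximate value of `s n` and then into these pieces, form
a partition for the next scale; up to the diameter of `T` and absolute constants, its chaining sum
is at most `a` times the old one plus the chaining sum of `s`. -/
theorem ChainBound.contract {Δ₀ a S : ℝ} (ha : 0 ≤ a) (hS : 0 < S)
    (hΔ : ∀ x y, dist (F x) (F y) ≤ Δ₀) {s : ℕ → T → ℝ} (hs0 : ∀ n x, 0 ≤ s n x)
    (hsS : ∀ x, ∑ n ∈ Finset.range (N + 1), 2 ^ n * s n x ≤ S)
    (hcov : ∀ n ≤ N, ∀ (A : Set T) (Δ σ : ℝ), (∀ x ∈ A, ∀ y ∈ A, dist (F x) (F y) ≤ Δ) →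
      (∀ x ∈ A, s n x ≤ σ) → ∃ c : T → Fin (2 ^ 4 ^ (n + 1)),
        ∀ x ∈ A, ∀ y ∈ A, c x = c y → dist (F x) (F y) ≤ a * Δ + σ)
    (h : ChainBound F N Γ) : ChainBound F N (Δ₀ + 2 * (a * Γ + 3 * S)) := by
  obtain ⟨ι, hι, c, δ, -, h1, h2, h3⟩ := h
  have hδ0 : ∀ n ≤ N, ∀ x, 0 ≤ δ n (c n x) := fun n hn x => dist_nonneg.trans (h2 n hn x x rfl)
  -- the discretized value of `s n`
  have hlev : ∀ n ≤ N, ∀ x, ⌈s n x * 4 ^ n / S⌉₊ < 2 ^ n + 1 := by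
    intro n hn x
    have h4 : 2 ^ n * s n x ≤ S :=
      (Finset.single_le_sum (f := fun n => 2 ^ n * s n x)
        (fun i _ => mul_nonneg (by positivity) (hs0 i x))
        (Finset.mem_range.2 (Nat.lt_succ_of_le hn))).trans (hsS x)
    rw [Nat.lt_succ_iff, Nat.ceil_le]
    push_cast
    rw [div_le_iff₀ hS]
    have : (4 : ℝ) ^ n = 2 ^ n * 2 ^ n := by rw [← mul_pow]; norm_num
    rw [this]
    nlinarith [pow_pos (two_pos : (0 : ℝ) < 2) n]
  let lev : ∀ n, T → Fin (2 ^ n + 1) := fun n x => Fin.ofNat _ ⌈s n x * 4 ^ n / S⌉₊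
  have hlevval : ∀ n ≤ N, ∀ x, ((lev n x : ℕ) : ℝ) = ⌈s n x * 4 ^ n / S⌉₊ := fun n hn x => by
    simp only [lev, Fin.val_ofNat, Nat.mod_eq_of_lt (hlev n hn x)]
  have hcov' : ∀ n, ∀ i : ι n, ∀ l : Fin (2 ^ n + 1), ∃ c' : T → Fin (2 ^ 4 ^ (n + 1)),
      n ≤ N → ∀ x y, c n x = i → c n y = i → lev n x = l → lev n y = l → c' x = c' y →
        dist (F x) (F y) ≤ a * δ n i + l * (S / 4 ^ n) := by
    intro n i l
    by_cases hn : n ≤ N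
    · obtain ⟨c', hc'⟩ := hcov n hn {x | c n x = i ∧ lev n x = l} (δ n i) (l * (S / 4 ^ n))
        (by rintro x ⟨rfl, -⟩ y ⟨hy, -⟩; exact h2 n hn x y hy.symm)
        (by
          rintro x ⟨-, rfl⟩
          rw [hlevval n hn x]
          have := Nat.le_ceil (s n x * 4 ^ n / S)
          calc s n x = s n x * 4 ^ n / S * (S / 4 ^ n) := by field_simp
            _ ≤ _ := by gcongr)
      exact ⟨c', fun _ x y h1 h2 h3 h4 h5 => hc' x ⟨h1, h3⟩ y ⟨h2, h4⟩ h5⟩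
    · exact ⟨fun _ => ⟨0, by positivity⟩, fun h => absurd h hn⟩
  choose cov hcov2 using hcov'
  let ι' : ℕ → Type := fun n => match n with
    | 0 => Unit
    | n + 1 => ι n × Fin (2 ^ n + 1) × Fin (2 ^ 4 ^ (n + 1))
  let hι' : ∀ n, Fintype (ι' n) := fun n => match n with
    | 0 => inferInstanceAs (Fintype Unit)
    | n + 1 => inferInstanceAs (Fintype (ι n × Fin (2 ^ n + 1) × Fin (2 ^ 4 ^ (n + 1))))
  let c' : ∀ n, T → ι' n := fun n => match n with
    | 0 => fun _ => ()
    | n + 1 => fun x => (c n x, lev n x, cov n (c n x) (lev n x) x)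
  let δ' : ∀ n, ι' n → ℝ := fun n => match n with
    | 0 => fun _ => Δ₀
    | n + 1 => fun i => a * δ n i.1 + i.2.1 * (S / 4 ^ n)
  refine ⟨ι', hι', c', δ', inferInstanceAs (Subsingleton Unit), ?_, ?_, ?_⟩
  · rintro (_ | n)
    · exact (by simp : Fintype.card Unit ≤ 2 ^ 4 ^ (0 + 1))
    · change Fintype.card (ι n × Fin (2 ^ n + 1) × Fin (2 ^ 4 ^ (n + 1))) ≤ _
      rw [Fintype.card_prod, Fintype.card_prod, Fintype.card_fin, Fintype.card_fin]
      have hlv : 2 ^ n + 1 ≤ 2 ^ 4 ^ (n + 1) := by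
        have : n + 1 ≤ 4 ^ (n + 1) := (Nat.lt_pow_self (by norm_num)).le
        calc 2 ^ n + 1 ≤ 2 ^ n + 2 ^ n := by gcongr; exact Nat.one_le_two_pow
          _ = 2 ^ (n + 1) := by ring
          _ ≤ _ := Nat.pow_le_pow_right (by norm_num) this
      calc _ ≤ 2 ^ 4 ^ (n + 1) * (2 ^ 4 ^ (n + 1) * 2 ^ 4 ^ (n + 1)) := by
            gcongr; exact h1 n
        _ = 2 ^ (3 * 4 ^ (n + 1)) := by rw [← pow_add, ← pow_add]; congr 1; ring
        _ ≤ _ := Nat.pow_le_pow_right (by norm_num) (by rw [pow_succ 4 (n + 1)]; omega)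
  · rintro (_ | n) hn x y hxy
    · exact hΔ x y
    · have e1 : c n y = c n x := (congrArg (fun z => z.1) hxy).symm
      have e2 : lev n y = lev n x := (congrArg (fun z => z.2.1) hxy).symm
      have e3 : cov n (c n x) (lev n x) x = cov n (c n y) (lev n y) y :=
        congrArg (fun z => z.2.2) hxy
      rw [e1, e2] at e3
      exact hcov2 n _ _ (by omega) x y rfl e1 rfl e2 e3
  · intro x
    rw [Finset.sum_range_succ']
    have hterm : ∀ n ∈ Finset.range N, (2 : ℝ) ^ (n + 1) * δ' (n + 1) (c' (n + 1) x)
        ≤ 2 * a * (2 ^ n * δ n (c n x)) + 2 * (2 ^ n * s n x) + 2 * S * (1 / 2) ^ n := by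
      intro n hn
      have hnN : n ≤ N := (Finset.mem_range.1 hn).le
      change (2 : ℝ) ^ (n + 1) * (a * δ n (c n x) + ((lev n x : ℕ) : ℝ) * (S / 4 ^ n)) ≤ _
      have hl : ((lev n x : ℕ) : ℝ) * (S / 4 ^ n) ≤ s n x + S / 4 ^ n := by
        rw [hlevval n hnN x]
        have := (Nat.ceil_lt_add_one (a := s n x * 4 ^ n / S)
          (div_nonneg (mul_nonneg (hs0 n x) (by positivity)) hS.le)).le
        calc _ ≤ (s n x * 4 ^ n / S + 1) * (S / 4 ^ n) := by gcongr
          _ = _ := by field_simp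
      calc _ ≤ (2 : ℝ) ^ (n + 1) * (a * δ n (c n x) + (s n x + S / 4 ^ n)) := by gcongr
        _ = 2 * a * (2 ^ n * δ n (c n x)) + 2 * (2 ^ n * s n x) + 2 * S * (2 ^ n / 4 ^ n) := by ring
        _ = _ := by rw [← div_pow]; norm_num
    have hgeo : ∑ n ∈ Finset.range N, ((1 : ℝ) / 2) ^ n ≤ 2 := by
      have := sum_geometric_two_le N
      simpa using this
    have hA : ∑ n ∈ Finset.range N, 2 ^ n * δ n (c n x) ≤ Γ := by
      refine le_trans ?_ (h3 x)
      rw [Finset.sum_range_succ]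
      linarith [mul_nonneg (pow_nonneg (zero_le_two (α := ℝ)) N) (hδ0 N le_rfl x)]
    have hB : ∑ n ∈ Finset.range N, 2 ^ n * s n x ≤ S := by
      refine le_trans ?_ (hsS x)
      rw [Finset.sum_range_succ]
      linarith [mul_nonneg (pow_nonneg (zero_le_two (α := ℝ)) N) (hs0 N x)]
    have hsum := Finset.sum_le_sum hterm
    rw [Finset.sum_add_distrib, Finset.sum_add_distrib, ← Finset.mul_sum, ← Finset.mul_sum,
      ← Finset.mul_sum] at hsum
    have h0 : (2 : ℝ) ^ 0 * δ' 0 (c' 0 x) = Δ₀ := by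
      change (2 : ℝ) ^ 0 * Δ₀ = Δ₀
      ring
    rw [h0]
    nlinarith [mul_le_mul_of_nonneg_left hA ha, mul_le_mul_of_nonneg_left hgeo hS.le]

/-- The contraction principle: with contraction factor `1 / 4`, iterating
`ChainBound.contract` removes the dependence on the initial partition. -/
theorem ChainBound.of_contraction {Δ₀ S : ℝ} (hS : 0 < S) (hΔ0 : 0 ≤ Δ₀)
    (hΔ : ∀ x y, dist (F x) (F y) ≤ Δ₀) {s : ℕ → T → ℝ} (hs0 : ∀ n x, 0 ≤ s n x)
    (hsS : ∀ x, ∑ n ∈ Finset.range (N + 1), 2 ^ n * s n x ≤ S)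
    (hcov : ∀ n ≤ N, ∀ (A : Set T) (Δ σ : ℝ), (∀ x ∈ A, ∀ y ∈ A, dist (F x) (F y) ≤ Δ) →
      (∀ x ∈ A, s n x ≤ σ) → ∃ c : T → Fin (2 ^ 4 ^ (n + 1)),
        ∀ x ∈ A, ∀ y ∈ A, c x = c y → dist (F x) (F y) ≤ 1 / 4 * Δ + σ) :
    ChainBound F N (3 * (Δ₀ + 6 * S)) := by
  set Γ₀ := ∑ n ∈ Finset.range (N + 1), 2 ^ n * Δ₀ with hΓ₀
  have hB : 0 < Δ₀ + 6 * S := by positivity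
  have hit : ∀ k : ℕ, ChainBound F N (2 * (Δ₀ + 6 * S) + (1 / 2) ^ k * Γ₀) := by
    intro k
    induction k with
    | zero => exact (ChainBound.of_diam hΔ).mono (by simp only [pow_zero, one_mul]; linarith)
    | succ k ih =>
      refine (ih.contract (by norm_num) hS hΔ hs0 hsS hcov).mono (le_of_eq ?_)
      ring
  obtain ⟨k, hk⟩ := exists_pow_lt_of_lt_one (show 0 < (Δ₀ + 6 * S) / (Γ₀ + 1) by positivity)
    (show (1 / 2 : ℝ) < 1 by norm_num)
  refine (hit k).mono ?_
  have hG : 0 ≤ Γ₀ := by positivity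
  rw [lt_div_iff₀ (by positivity)] at hk
  nlinarith [pow_pos (show (0 : ℝ) < 1 / 2 by norm_num) k]

end Contraction

/-! ### Chaining for Rademacher sums -/

/-- The sign `±1` encoded by a Boolean. -/
def boolSign (b : Bool) : ℝ := if b then 1 else -1

theorem abs_boolSign (b : Bool) : |boolSign b| = 1 := by
  cases b <;> simp [boolSign]

theorem sum_exp_rademacher_le {m : ℕ} (a : Fin m → ℝ) :
    ∑ ε : Fin m → Bool, Real.exp (∑ j, boolSign (ε j) * a j)
      ≤ 2 ^ m * Real.exp ((∑ j, a j ^ 2) / 2) := by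
  have h1 : ∑ ε : Fin m → Bool, Real.exp (∑ j, boolSign (ε j) * a j)
      = ∏ j, ∑ b : Bool, Real.exp (boolSign b * a j) := by
    simp_rw [Real.exp_sum]
    rw [Finset.prod_univ_sum, Fintype.piFinset_univ]
  rw [h1, Finset.sum_div, Real.exp_sum]
  calc _ ≤ ∏ j, (2 * Real.exp (a j ^ 2 / 2)) := by
        refine Finset.prod_le_prod (fun j _ => by positivity) fun j _ => ?_
        have := Real.cosh_le_exp_half_sq (a j)
        rw [Real.cosh_eq] at this
        simp only [Fintype.sum_bool, boolSign, if_true, one_mul, Bool.false_eq_true, if_false]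
        rw [neg_one_mul]
        linarith
    _ = _ := by rw [Finset.prod_mul_distrib]; simp

/-- Subgaussian tails of Rademacher sums in exponential form, normalized by `r`; at `r = 0` the
coefficients vanish and so does the quotient. -/
theorem sum_exp_abs_rademacher_le {m : ℕ} (a : Fin m → ℝ) {r η : ℝ}
    (hr : ∑ j, a j ^ 2 = r ^ 2) :
    ∑ ε : Fin m → Bool, Real.exp (η * (|∑ j, boolSign (ε j) * a j| / r))
      ≤ 2 ^ m * (2 * Real.exp (η ^ 2 / 2)) := by
  have key : ∀ t : ℝ, t ^ 2 ≤ η ^ 2 / r ^ 2 →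
      ∑ ε : Fin m → Bool, Real.exp (t * ∑ j, boolSign (ε j) * a j)
        ≤ 2 ^ m * Real.exp (η ^ 2 / 2) := by
    intro t ht
    have := sum_exp_rademacher_le (fun j => t * a j)
    refine le_trans (le_of_eq ?_) (this.trans ?_)
    · refine Finset.sum_congr rfl fun ε _ => ?_
      rw [Finset.mul_sum]
      congr 1
      exact Finset.sum_congr rfl fun j _ => by ring
    · gcongr
      simp_rw [mul_pow]
      rw [← Finset.mul_sum, hr]
      rcases eq_or_ne r 0 with rfl | h0
      · simp [sq_nonneg]
      · calc t ^ 2 * r ^ 2 ≤ η ^ 2 / r ^ 2 * r ^ 2 := by gcongr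
          _ = η ^ 2 := by field_simp
  have h1 := key (η / r) (by rw [div_pow])
  have h2 := key (-(η / r)) (by rw [neg_sq, div_pow])
  calc _ ≤ ∑ ε : Fin m → Bool, (Real.exp (η / r * ∑ j, boolSign (ε j) * a j)
        + Real.exp (-(η / r) * ∑ j, boolSign (ε j) * a j)) := by
        refine Finset.sum_le_sum fun ε _ => ?_
        rcases abs_choice (∑ j, boolSign (ε j) * a j) with h | h <;> rw [h]
        · rw [show ∀ z : ℝ, η * (z / r) = η / r * z by intro z; ring]
          linarith [Real.exp_pos (-(η / r) * ∑ j, boolSign (ε j) * a j)]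
        · rw [show ∀ z : ℝ, η * (-z / r) = -(η / r) * z by intro z; ring]
          linarith [Real.exp_pos ((η / r) * ∑ j, boolSign (ε j) * a j)]
    _ ≤ _ := by rw [Finset.sum_add_distrib]; linarith

theorem abs_rademacher_le {m N : ℕ} (hm : m ≤ 4 ^ N) (ε : Fin m → Bool) (a : Fin m → ℝ) :
    |∑ j, boolSign (ε j) * a j| ≤ 2 ^ N * √(∑ j, a j ^ 2) := by
  have h1 : (∑ j, boolSign (ε j) * a j) ^ 2 ≤ (∑ j, boolSign (ε j) ^ 2) * ∑ j, a j ^ 2 :=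
    Finset.sum_mul_sq_le_sq_mul_sq _ _ _
  have h2 : ∑ j, boolSign (ε j) ^ 2 = m := by
    simp [← sq_abs (boolSign _), abs_boolSign]
  rw [h2] at h1
  have hm' : (m : ℝ) ≤ (2 ^ N) ^ 2 := by
    rw [← pow_mul, mul_comm, pow_mul]; norm_num; exact_mod_cast hm
  rw [← Real.sqrt_sq_eq_abs, ← Real.sqrt_sq (show (0 : ℝ) ≤ 2 ^ N by positivity),
    ← Real.sqrt_mul (by positivity)]
  apply Real.sqrt_le_sqrt
  exact h1.trans (by gcongr)

/-- Simultaneous control of Rademacher sums at `N` scales: a union bound over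
`2 ^ (20 * 4 ^ n)` sums at scale `n` costs a factor `2 ^ n`, up to a random variable `Y` of
bounded mean that is common to all scales. -/
theorem exists_uniform_rademacher_bound {m N : ℕ} (hm : m ≤ 4 ^ N) {κ : ℕ → Type}
    [∀ n, Fintype (κ n)] (hκ : ∀ n, Fintype.card (κ n) ≤ 2 ^ (20 * 4 ^ n))
    (a : ∀ n, κ n → Fin m → ℝ) :
    ∃ Y : (Fin m → Bool) → ℝ, (∀ ε, 0 ≤ Y ε) ∧ ∑ ε, Y ε ≤ 2 ^ m * 2 ∧
      ∀ ε, ∀ n < N, ∀ i, |∑ j, boolSign (ε j) * a n i j|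
        ≤ 2 ^ n * (23 + Y ε) * √(∑ j, a n i j ^ 2) := by
  obtain ⟨g, hg⟩ : ∃ g : ∀ n, κ n → (Fin m → Bool) → ℝ, ∀ n i ε, g n i ε =
      Real.exp (-(23 * 4 ^ n)) *
        Real.exp (2 ^ n * (|∑ j, boolSign (ε j) * a n i j| / √(∑ j, a n i j ^ 2))) :=
    ⟨_, fun _ _ _ => rfl⟩
  have hg0 : ∀ n i ε, 0 ≤ g n i ε := fun n i ε => by rw [hg]; positivity
  have hY0 : ∀ ε, 0 ≤ ∑ n ∈ Finset.range N, ∑ i, g n i ε := fun ε =>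
    Finset.sum_nonneg fun n _ => Finset.sum_nonneg fun i _ => hg0 n i ε
  have hone : ∀ n i, ∑ ε, g n i ε
      ≤ Real.exp (-(23 * 4 ^ n)) * (2 ^ m * (2 * Real.exp (4 ^ n / 2))) := by
    intro n i
    simp_rw [hg]
    rw [← Finset.mul_sum]
    gcongr
    have := sum_exp_abs_rademacher_le (η := 2 ^ n) (a n i)
      (Real.sq_sqrt (Finset.sum_nonneg fun j _ => sq_nonneg (a n i j))).symm
    rwa [show ((2 : ℝ) ^ n) ^ 2 = 4 ^ n by rw [← pow_mul, mul_comm, pow_mul]; norm_num] at this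
  have hscale : ∀ n, ∑ i, ∑ ε, g n i ε ≤ 2 ^ m * (1 / 2) ^ n := by
    intro n
    have hcard : (Fintype.card (κ n) : ℝ) ≤ Real.exp (20 * 4 ^ n) := by
      calc (Fintype.card (κ n) : ℝ) ≤ (2 : ℝ) ^ (20 * 4 ^ n) := by exact_mod_cast hκ n
        _ ≤ (Real.exp 1) ^ (20 * 4 ^ n) := by
            gcongr
            linarith [Real.add_one_le_exp (1 : ℝ)]
        _ = _ := by rw [← Real.exp_nat_mul]; push_cast; ring_nf
    have hn1 : ((n : ℝ) + 1) ≤ 4 ^ n := by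
      have : n + 1 ≤ 4 ^ n := Nat.lt_pow_self (by norm_num)
      exact_mod_cast this
    calc _ ≤ ∑ i : κ n, Real.exp (-(23 * 4 ^ n)) * (2 ^ m * (2 * Real.exp (4 ^ n / 2))) :=
          Finset.sum_le_sum fun i _ => hone n i
      _ = Fintype.card (κ n) *
          (Real.exp (-(23 * 4 ^ n)) * (2 ^ m * (2 * Real.exp (4 ^ n / 2)))) := by
          rw [Finset.sum_const, nsmul_eq_mul, Finset.card_univ]
      _ ≤ Real.exp (20 * 4 ^ n) *
          (Real.exp (-(23 * 4 ^ n)) * (2 ^ m * (2 * Real.exp (4 ^ n / 2)))) := by gcongr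
      _ = 2 ^ m * (2 * Real.exp (20 * 4 ^ n + -(23 * 4 ^ n) + 4 ^ n / 2)) := by
          rw [Real.exp_add, Real.exp_add]; ring
      _ ≤ 2 ^ m * (Real.exp 1 * Real.exp (20 * 4 ^ n + -(23 * 4 ^ n) + 4 ^ n / 2)) := by
          gcongr
          linarith [Real.add_one_le_exp (1 : ℝ)]
      _ ≤ 2 ^ m * Real.exp (-n) := by
          rw [← Real.exp_add]
          gcongr
          have : (0 : ℝ) ≤ n := by positivity
          linarith
      _ ≤ 2 ^ m * (1 / 2) ^ n := by
          rw [show (-(n : ℝ)) = n * (-1) by ring, Real.exp_nat_mul, Real.exp_neg]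
          gcongr
          rw [one_div]
          gcongr
          linarith [Real.add_one_le_exp (1 : ℝ)]
  refine ⟨fun ε => ∑ n ∈ Finset.range N, ∑ i, g n i ε, hY0, ?_, ?_⟩
  · rw [Finset.sum_comm]
    calc _ ≤ ∑ n ∈ Finset.range N, (2 : ℝ) ^ m * (1 / 2) ^ n := by
          refine Finset.sum_le_sum fun n _ => ?_
          rw [Finset.sum_comm]
          exact hscale n
      _ ≤ _ := by
          rw [← Finset.mul_sum]
          have := sum_geometric_two_le N
          gcongr
  · intro ε n hn i
    set Y := ∑ n ∈ Finset.range N, ∑ i, g n i ε with hY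
    have hYge : g n i ε ≤ Y :=
      (Finset.single_le_sum (f := fun i => g n i ε) (fun i _ => hg0 n i ε)
        (Finset.mem_univ i)).trans
      (Finset.single_le_sum (f := fun n => ∑ i, g n i ε)
        (fun n _ => Finset.sum_nonneg fun i _ => hg0 n i ε) (Finset.mem_range.2 hn))
    have hYε : 0 ≤ Y := hY0 ε
    rw [hg, ← Real.exp_add] at hYge
    have hlog := (Real.add_one_le_exp _).trans hYge
    have h2n : (1 : ℝ) ≤ 2 ^ n := one_le_pow₀ (by norm_num)
    have h4n : (4 : ℝ) ^ n = 2 ^ n * 2 ^ n := by rw [← mul_pow]; norm_num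
    have hr0 : 0 ≤ √(∑ j, a n i j ^ 2) := Real.sqrt_nonneg _
    rcases hr0.eq_or_lt with h0 | h0
    · have hz := abs_rademacher_le hm ε (a n i)
      rw [← h0] at hz ⊢
      linarith
    · have hξ : |∑ j, boolSign (ε j) * a n i j| / √(∑ j, a n i j ^ 2) ≤ 2 ^ n * (23 + Y) := by
        rw [h4n] at hlog
        refine le_of_mul_le_mul_left (a := (2 : ℝ) ^ n) ?_ (by positivity)
        nlinarith [mul_le_mul h2n h2n zero_le_one (by positivity)]
      rwa [div_le_iff₀ h0] at hξ

/-- Generic chaining for a Rademacher process. Scales beyond `N` are not needed, since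
`m ≤ 4 ^ N` makes every Rademacher sum `2 ^ N`-Lipschitz in its coefficients. -/
theorem ChainBound.rademacher {T V : Type*} [PseudoMetricSpace V] {F : T → V} {N m : ℕ} {Γ : ℝ}
    (hΓ : 0 ≤ Γ) (hm : m ≤ 4 ^ N) (φ : T → Fin m → ℝ)
    (hφ : ∀ x y, √(∑ j, (φ x j - φ y j) ^ 2) ≤ dist (F x) (F y)) (h : ChainBound F N Γ) :
    ∃ W : (Fin m → Bool) → ℝ, ∑ ε, W ε ≤ 2 ^ m * (102 * Γ) ∧
      ∀ ε x y, |∑ j, boolSign (ε j) * (φ x j - φ y j)| ≤ W ε := by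
  classical
  obtain ⟨ι, hι, c, δ, hsub, h1, h2, h3⟩ := h
  rcases isEmpty_or_nonempty T with hT | hT
  · exact ⟨fun _ => 0, by simp; positivity, fun _ x => hT.elim x⟩
  have hrep : ∀ n (i : ι n), ∃ z : T, ∀ x, c n x = i → c n z = i := by
    intro n i
    by_cases hx : ∃ x, c n x = i
    · obtain ⟨x, hx⟩ := hx
      exact ⟨x, fun _ _ => hx⟩
    · exact ⟨Classical.arbitrary T, fun x hx' => absurd ⟨x, hx'⟩ hx⟩
  choose rep hrep using hrep
  have hdx : ∀ n ≤ N, ∀ x, dist (F x) (F (rep n (c n x))) ≤ δ n (c n x) := fun n hn x =>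
    h2 n hn x _ (hrep n (c n x) x rfl).symm
  have hδ0 : ∀ n ≤ N, ∀ x, 0 ≤ δ n (c n x) := fun n hn x => dist_nonneg.trans (h2 n hn x x rfl)
  let Z : (Fin m → Bool) → T → T → ℝ := fun ε x y => ∑ j, boolSign (ε j) * (φ x j - φ y j)
  have hZadd : ∀ ε x y z, Z ε x z = Z ε x y + Z ε y z := by
    intro ε x y z
    simp only [Z]
    rw [← Finset.sum_add_distrib]
    exact Finset.sum_congr rfl fun j _ => by ring
  obtain ⟨Y, hY0, hYsum, hYlink⟩ := exists_uniform_rademacher_bound hm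
    (κ := fun n => ι n × ι (n + 1))
    (fun n => by
      rw [Fintype.card_prod]
      calc _ ≤ 2 ^ 4 ^ (n + 1) * 2 ^ 4 ^ (n + 1 + 1) := Nat.mul_le_mul (h1 _) (h1 _)
        _ = _ := by rw [← pow_add]; congr 1; ring)
    (fun n i j => φ (rep n i.1) j - φ (rep (n + 1) i.2) j)
  have hlink : ∀ ε, ∀ n < N, ∀ x, |Z ε (rep n (c n x)) (rep (n + 1) (c (n + 1) x))|
      ≤ (23 + Y ε) * (2 ^ n * δ n (c n x) + 2 ^ (n + 1) * δ (n + 1) (c (n + 1) x)) := by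
    intro ε n hn x
    set u := rep n (c n x)
    set v := rep (n + 1) (c (n + 1) x)
    have hruv : √(∑ j, (φ u j - φ v j) ^ 2) ≤ δ n (c n x) + δ (n + 1) (c (n + 1) x) := by
      refine (hφ u v).trans ((dist_triangle_left (F u) (F v) (F x)).trans ?_)
      exact add_le_add (hdx n hn.le x) (hdx (n + 1) hn x)
    have hδ1 := hδ0 (n + 1) hn x
    have hδn := hδ0 n hn.le x
    calc _ ≤ 2 ^ n * (23 + Y ε) * √(∑ j, (φ u j - φ v j) ^ 2) :=
          hYlink ε n hn (c n x, c (n + 1) x)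
      _ ≤ 2 ^ n * (23 + Y ε) * (δ n (c n x) + δ (n + 1) (c (n + 1) x)) := by
          have := hY0 ε
          gcongr
      _ = (23 + Y ε) * (2 ^ n * δ n (c n x) + 2 ^ n * δ (n + 1) (c (n + 1) x)) := by ring
      _ ≤ _ := by
          have := hY0 ε
          gcongr
          · norm_num
          · omega
  -- telescoping along the chain
  have hchain : ∀ ε x, ∀ k ≤ N, |Z ε (rep 0 (c 0 x)) (rep k (c k x))|
      ≤ ∑ n ∈ Finset.range k, (23 + Y ε) *
        (2 ^ n * δ n (c n x) + 2 ^ (n + 1) * δ (n + 1) (c (n + 1) x)) := by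
    intro ε x k
    induction k with
    | zero => intro _; simp [Z]
    | succ k ih =>
      intro hk
      rw [hZadd ε _ (rep k (c k x)), Finset.sum_range_succ]
      exact (abs_add_le _ _).trans (add_le_add (ih (by omega)) (hlink ε k hk x))
  have hsum : ∀ ε x, |Z ε (rep 0 (c 0 x)) x| ≤ (47 + 2 * Y ε) * Γ := by
    intro ε x
    have e1 := hchain ε x N le_rfl
    have e2 := abs_rademacher_le hm ε (fun j => φ x j - φ (rep N (c N x)) j)
    have e3 : |Z ε x (rep N (c N x))| ≤ 2 ^ N * δ N (c N x) :=
      e2.trans (by gcongr; exact (hφ _ _).trans (hdx N le_rfl x))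
    have e4 := h3 x
    rw [← Finset.mul_sum, Finset.sum_add_distrib] at e1
    have e5 : ∑ n ∈ Finset.range N, 2 ^ n * δ n (c n x) ≤ Γ := by
      rw [Finset.sum_range_succ] at e4
      linarith [mul_nonneg (pow_nonneg (zero_le_two (α := ℝ)) N) (hδ0 N le_rfl x)]
    have e6 : ∑ n ∈ Finset.range N, 2 ^ (n + 1) * δ (n + 1) (c (n + 1) x) ≤ Γ := by
      rw [Finset.sum_range_succ'] at e4
      linarith [mul_nonneg (pow_nonneg (zero_le_two (α := ℝ)) 0) (hδ0 0 (Nat.zero_le _) x)]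
    have e7 : 2 ^ N * δ N (c N x) ≤ Γ := by
      refine le_trans ?_ e4
      exact Finset.single_le_sum (f := fun n => 2 ^ n * δ n (c n x))
        (fun i hi => mul_nonneg (by positivity) (hδ0 i (by simpa [Nat.lt_succ_iff] using hi) x))
        (Finset.mem_range.2 (Nat.lt_succ_self N))
    have e8 : Z ε x (rep N (c N x)) = - Z ε (rep N (c N x)) x := by
      simp only [Z]
      rw [← Finset.sum_neg_distrib]
      exact Finset.sum_congr rfl fun j _ => by ring
    rw [e8, abs_neg] at e3
    rw [hZadd ε _ (rep N (c N x))]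
    refine (abs_add_le _ _).trans ?_
    have := hY0 ε
    have e9 := mul_le_mul_of_nonneg_left (add_le_add e5 e6) (show 0 ≤ 23 + Y ε by linarith)
    linarith
  refine ⟨fun ε => (94 + 4 * Y ε) * Γ, ?_, ?_⟩
  · rw [← Finset.sum_mul, Finset.sum_add_distrib, ← Finset.mul_sum]
    have : ∑ _ε : Fin m → Bool, (94 : ℝ) = 2 ^ m * 94 := by simp
    rw [this]
    nlinarith [mul_le_mul_of_nonneg_right hYsum hΓ]
  · intro ε x y
    have hc0 : c 0 y = c 0 x := Subsingleton.elim _ _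
    have ex := hsum ε x
    have ey := hsum ε y
    rw [hc0] at ey
    change |Z ε x y| ≤ _
    have := hZadd ε (rep 0 (c 0 x)) x y
    have e : Z ε x y = Z ε (rep 0 (c 0 x)) y - Z ε (rep 0 (c 0 x)) x := by linarith
    rw [e]
    refine (abs_sub _ _).trans ?_
    linarith

/-! ### Covering Euclidean balls by Gaussian measure -/

theorem gaussian_complete_square {E : Type*} [NormedAddCommGroup E] [InnerProductSpace ℝ E]
    (v x : E) :
    Real.exp (-‖x‖ ^ 2 / 2) * Real.exp (inner ℝ v x)
      = Real.exp (‖v‖ ^ 2 / 2) * Real.exp (-‖x - v‖ ^ 2 / 2) := by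
  rw [← Real.exp_add, ← Real.exp_add, norm_sub_sq_real, real_inner_comm]
  ring_nf

section Gaussian

variable {E : Type*} [NormedAddCommGroup E] [InnerProductSpace ℝ E] [FiniteDimensional ℝ E]
  [MeasurableSpace E] [BorelSpace E]

theorem integral_gaussian_pos : 0 < ∫ x : E, Real.exp (-‖x‖ ^ 2 / 2) := by
  have h := GaussianFourier.integral_rexp_neg_mul_sq_norm (V := E) (b := 1 / 2) (by norm_num)
  have h2 : ∀ x : E, Real.exp (-‖x‖ ^ 2 / 2) = Real.exp (-(1 / 2) * ‖x‖ ^ 2) := fun x => by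
    ring_nf
  simp_rw [h2, h]
  positivity

theorem integrable_gaussian : Integrable fun x : E => Real.exp (-‖x‖ ^ 2 / 2) :=
  Integrable.of_integral_ne_zero integral_gaussian_pos.ne'

theorem integrable_gaussian_mul_exp_inner (v : E) :
    Integrable fun x : E => Real.exp (-‖x‖ ^ 2 / 2) * Real.exp (inner ℝ v x) := by
  simp_rw [gaussian_complete_square]
  exact (integrable_gaussian.comp_sub_right v).const_mul _

theorem integral_gaussian_mul_exp_inner (v : E) :
    ∫ x : E, Real.exp (-‖x‖ ^ 2 / 2) * Real.exp (inner ℝ v x)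
      = Real.exp (‖v‖ ^ 2 / 2) * ∫ x : E, Real.exp (-‖x‖ ^ 2 / 2) := by
  simp_rw [gaussian_complete_square]
  rw [integral_const_mul, integral_sub_right_eq_self (fun x : E => Real.exp (-‖x‖ ^ 2 / 2))]

theorem integral_gaussian_mul_cosh_inner (v : E) :
    Integrable (fun x : E => Real.exp (-‖x‖ ^ 2 / 2) *
      (Real.exp (inner ℝ v x) + Real.exp (-inner ℝ v x))) ∧
    ∫ x : E, Real.exp (-‖x‖ ^ 2 / 2) * (Real.exp (inner ℝ v x) + Real.exp (-inner ℝ v x))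
      = 2 * Real.exp (‖v‖ ^ 2 / 2) * ∫ x : E, Real.exp (-‖x‖ ^ 2 / 2) := by
  have h1 := integrable_gaussian_mul_exp_inner v
  have h2 := integrable_gaussian_mul_exp_inner (-v)
  have e1 := integral_gaussian_mul_exp_inner v
  have e2 := integral_gaussian_mul_exp_inner (-v)
  simp_rw [inner_neg_left] at h2 e2
  simp_rw [mul_add]
  refine ⟨h1.add h2, ?_⟩
  rw [integral_add h1 h2, e1, e2, norm_neg]
  ring

/-- A translate by `v` of a symmetric set keeps at least the fraction `exp (-‖v‖ ^ 2 / 2)` of its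
Gaussian measure. -/
theorem gaussian_translate_ge {S : Set E} (hS : MeasurableSet S) (hsymm : ∀ x ∈ S, -x ∈ S)
    (v : E) :
    Real.exp (-‖v‖ ^ 2 / 2) * ∫ x in S, Real.exp (-‖x‖ ^ 2 / 2)
      ≤ ∫ x in {x | x - v ∈ S}, Real.exp (-‖x‖ ^ 2 / 2) := by
  have hSv : MeasurableSet {x | x - v ∈ S} := hS.preimage (by fun_prop)
  have hneg : ∀ x, -x ∈ S ↔ x ∈ S := fun x =>
    ⟨fun h => by simpa using hsymm _ h, fun h => hsymm _ h⟩
  have e1 : ∫ x in {x | x - v ∈ S}, Real.exp (-‖x‖ ^ 2 / 2)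
      = ∫ x in S, Real.exp (-‖x + v‖ ^ 2 / 2) := by
    rw [← integral_indicator hSv, ← integral_indicator hS,
      ← integral_sub_right_eq_self (S.indicator fun x : E => Real.exp (-‖x + v‖ ^ 2 / 2)) v]
    congr 1
    ext x
    by_cases h : x - v ∈ S <;> simp [Set.indicator, h]
  have e2 : ∫ x in S, Real.exp (-‖x + v‖ ^ 2 / 2) = ∫ x in S, Real.exp (-‖x - v‖ ^ 2 / 2) := by
    rw [← integral_indicator hS, ← integral_indicator hS,
      ← integral_neg_eq_self (S.indicator fun x : E => Real.exp (-‖x + v‖ ^ 2 / 2))]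
    congr 1
    ext x
    have : ‖-x + v‖ = ‖x - v‖ := by rw [← norm_neg]; congr 1; abel
    by_cases h : x ∈ S <;> simp [Set.indicator, hneg, h, this]
  have hi1 : Integrable fun x : E => Real.exp (-‖x - v‖ ^ 2 / 2) :=
    integrable_gaussian.comp_sub_right v
  have hi2 : Integrable fun x : E => Real.exp (-‖x + v‖ ^ 2 / 2) :=
    integrable_gaussian.comp_add_right v
  have e3 : 2 * ∫ x in S, Real.exp (-‖x + v‖ ^ 2 / 2)
      = ∫ x in S, (Real.exp (-‖x + v‖ ^ 2 / 2) + Real.exp (-‖x - v‖ ^ 2 / 2)) := by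
    rw [integral_add hi2.integrableOn hi1.integrableOn, ← e2]
    ring
  have e4 : 2 * (Real.exp (-‖v‖ ^ 2 / 2) * ∫ x in S, Real.exp (-‖x‖ ^ 2 / 2))
      = ∫ x in S, 2 * Real.exp (-‖v‖ ^ 2 / 2) * Real.exp (-‖x‖ ^ 2 / 2) := by
    rw [integral_const_mul]
    ring
  have e5 : ∫ x in S, 2 * Real.exp (-‖v‖ ^ 2 / 2) * Real.exp (-‖x‖ ^ 2 / 2)
      ≤ ∫ x in S, (Real.exp (-‖x + v‖ ^ 2 / 2) + Real.exp (-‖x - v‖ ^ 2 / 2)) := by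
    refine integral_mono (integrable_gaussian.integrableOn.const_mul _)
      (hi2.integrableOn.add hi1.integrableOn) fun x => ?_
    have hc := Real.one_le_cosh (inner ℝ x v)
    rw [Real.cosh_eq] at hc
    have : Real.exp (-‖x + v‖ ^ 2 / 2) + Real.exp (-‖x - v‖ ^ 2 / 2)
        = Real.exp (-‖v‖ ^ 2 / 2) * Real.exp (-‖x‖ ^ 2 / 2) *
          (Real.exp (inner ℝ x v) + Real.exp (-inner ℝ x v)) := by
      rw [mul_add, ← Real.exp_add, ← Real.exp_add, ← Real.exp_add, norm_sub_sq_real,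
        norm_add_sq_real, add_comm]
      ring_nf
    simp only [this]
    have hp := mul_pos (Real.exp_pos (-‖v‖ ^ 2 / 2)) (Real.exp_pos (-‖x‖ ^ 2 / 2))
    nlinarith
  rw [e1]
  linarith

/-- A set of points of `closedBall 0 r` that is `2 r / 2 ^ n`-separated for the seminorm `‖L ·‖` is
small if the unit ball of that seminorm has at least half of the Gaussian measure. -/
theorem card_le_of_gaussian_separated {F : Type*} [NormedAddCommGroup F] [NormedSpace ℝ F]
    (L : E →L[ℝ] F)
    (hL : (∫ x : E, Real.exp (-‖x‖ ^ 2 / 2)) / 2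
      ≤ ∫ x in {x : E | ‖L x‖ ≤ 1}, Real.exp (-‖x‖ ^ 2 / 2))
    {r : ℝ} (hr : 0 < r) (n : ℕ) (I : Finset E) (hI : ∀ w ∈ I, ‖w‖ ≤ r)
    (hsep : ∀ w ∈ I, ∀ w' ∈ I, w ≠ w' → 2 * r / 2 ^ n < ‖L (w - w')‖) :
    I.card ≤ 2 ^ 4 ^ (n + 1) := by
  set S : Set E := {x : E | ‖L x‖ ≤ 1} with hSdef
  have hS : MeasurableSet S := (isClosed_le (by fun_prop) continuous_const).measurableSet
  have hsymm : ∀ x ∈ S, -x ∈ S := fun x hx => by simpa [hSdef] using hx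
  set θ : ℝ := 2 ^ n / r with hθ
  have hθ0 : 0 < θ := by positivity
  set Z := ∫ x : E, Real.exp (-‖x‖ ^ 2 / 2) with hZ
  have hZ0 : 0 < Z := integral_gaussian_pos
  have hmeas : ∀ w ∈ I, MeasurableSet {x | x - θ • w ∈ S} := fun w _ =>
    hS.preimage (by fun_prop)
  have hdisj : (I : Set E).Pairwise (Function.onFun Disjoint fun w => {x | x - θ • w ∈ S}) := by
    intro w hw w' hw' hne
    refine Set.disjoint_left.2 fun x hx hx' => ?_
    have h1 : ‖L (x - θ • w)‖ ≤ 1 := hx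
    have h2 : ‖L (x - θ • w')‖ ≤ 1 := hx'
    have h3 := hsep w hw w' hw' hne
    have h4 : θ * ‖L (w - w')‖ ≤ 2 := by
      have : L (x - θ • w') - L (x - θ • w) = θ • L (w - w') := by
        rw [← map_sub, ← map_smul]
        congr 1
        rw [smul_sub]
        abel
      rw [← abs_of_pos hθ0, ← Real.norm_eq_abs, ← norm_smul, ← this]
      exact (norm_sub_le _ _).trans (by linarith)
    have h5 : θ * (2 * r / 2 ^ n) = 2 := by rw [hθ]; field_simp
    nlinarith [mul_lt_mul_of_pos_left h3 hθ0]
  have hunion := integral_biUnion_finset (μ := volume) (f := fun x : E => Real.exp (-‖x‖ ^ 2 / 2))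
    I hmeas hdisj (fun w _ => integrable_gaussian.integrableOn)
  have hle : ∫ x in ⋃ w ∈ I, {x | x - θ • w ∈ S}, Real.exp (-‖x‖ ^ 2 / 2) ≤ Z :=
    setIntegral_le_integral integrable_gaussian (Filter.Eventually.of_forall fun x => by positivity)
  rw [hunion] at hle
  have hge : ∀ w ∈ I, Real.exp (-(4 ^ n) / 2) * (Z / 2)
      ≤ ∫ x in {x | x - θ • w ∈ S}, Real.exp (-‖x‖ ^ 2 / 2) := by
    intro w hw
    refine le_trans ?_ (gaussian_translate_ge hS hsymm (θ • w))
    have : ‖θ • w‖ ^ 2 ≤ 4 ^ n := by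
      rw [norm_smul, mul_pow, Real.norm_eq_abs, sq_abs, hθ, div_pow,
        show ((2 : ℝ) ^ n) ^ 2 = 4 ^ n by rw [← pow_mul, mul_comm, pow_mul]; norm_num]
      have hw2 : ‖w‖ ^ 2 ≤ r ^ 2 := pow_le_pow_left₀ (norm_nonneg _) (hI w hw) 2
      rw [div_mul_eq_mul_div, div_le_iff₀ (by positivity)]
      gcongr
    gcongr
  have hcard := (Finset.card_nsmul_le_sum _ _ _ hge).trans hle
  rw [nsmul_eq_mul] at hcard
  have hcard2 : (I.card : ℝ) ≤ 2 * Real.exp (4 ^ n / 2) := by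
    have : (I.card : ℝ) * Real.exp (-(4 ^ n) / 2) ≤ 2 := by nlinarith
    calc (I.card : ℝ) = I.card * Real.exp (-(4 ^ n) / 2) * Real.exp (4 ^ n / 2) := by
          rw [mul_assoc, ← Real.exp_add, show -(4 : ℝ) ^ n / 2 + 4 ^ n / 2 = 0 by ring,
            Real.exp_zero, mul_one]
      _ ≤ _ := by gcongr
  have hexp : Real.exp (4 ^ n / 2) ≤ 2 ^ 4 ^ n := by
    have h1 : Real.exp (1 / 2) ≤ 2 := by
      have := Real.exp_one_lt_d9
      have h2 : Real.exp (1 / 2) ^ 2 = Real.exp 1 := by rw [← Real.exp_nat_mul]; norm_num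
      nlinarith [Real.exp_pos (1 / 2 : ℝ)]
    calc Real.exp (4 ^ n / 2) = Real.exp (1 / 2) ^ 4 ^ n := by
          rw [← Real.exp_nat_mul]; push_cast; ring_nf
      _ ≤ _ := by gcongr
  have hfin : (I.card : ℝ) ≤ ((2 ^ 4 ^ (n + 1) : ℕ) : ℝ) := by
    push_cast
    calc (I.card : ℝ) ≤ 2 ^ 1 * 2 ^ 4 ^ n := by linarith
      _ = 2 ^ (1 + 4 ^ n) := by rw [pow_add]
      _ ≤ _ := by
        gcongr
        · norm_num
        · rw [pow_succ]
          have : 1 ≤ 4 ^ n := Nat.one_le_pow _ _ (by norm_num)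
          omega
  exact_mod_cast hfin

/-- Dual Sudakov minoration in the form used below: a maximal separated set yields a labelling of
`closedBall 0 r` by `2 ^ 4 ^ (n + 1)` labels with classes of diameter `4 r / 2 ^ n`. -/
theorem exists_cover_of_gaussian {F : Type*} [NormedAddCommGroup F] [NormedSpace ℝ F]
    (L : E →L[ℝ] F)
    (hL : (∫ x : E, Real.exp (-‖x‖ ^ 2 / 2)) / 2
      ≤ ∫ x in {x : E | ‖L x‖ ≤ 1}, Real.exp (-‖x‖ ^ 2 / 2))
    {r : ℝ} (hr : 0 < r) (n : ℕ) :
    ∃ c : E → Fin (2 ^ 4 ^ (n + 1)), ∀ w w', ‖w‖ ≤ r → ‖w'‖ ≤ r → c w = c w' →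
      ‖L (w - w')‖ ≤ 4 * r / 2 ^ n := by
  classical
  let Sep : Finset E → Prop := fun I => (∀ w ∈ I, ‖w‖ ≤ r) ∧
    ∀ w ∈ I, ∀ w' ∈ I, w ≠ w' → 2 * r / 2 ^ n < ‖L (w - w')‖
  have hbdd : ∀ I, Sep I → I.card ≤ 2 ^ 4 ^ (n + 1) := fun I hI =>
    card_le_of_gaussian_separated L hL hr n I hI.1 hI.2
  obtain ⟨k, ⟨I, hI, rfl⟩, hmax⟩ : ∃ k, (∃ I, Sep I ∧ I.card = k) ∧
      ∀ I, Sep I → I.card ≤ k := by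
    have h0 : ∃ I, Sep I ∧ I.card = 0 := ⟨∅, ⟨by simp, by simp⟩, rfl⟩
    refine ⟨Nat.findGreatest (fun k => ∃ I, Sep I ∧ I.card = k) (2 ^ 4 ^ (n + 1)), ?_, ?_⟩
    · exact Nat.findGreatest_spec (P := fun k => ∃ I, Sep I ∧ I.card = k) (Nat.zero_le _) h0
    · intro I hI
      exact Nat.le_findGreatest (hbdd I hI) ⟨I, hI, rfl⟩
  have hnear : ∀ w, ∃ i, ‖w‖ ≤ r → i ∈ I ∧ ‖L (w - i)‖ ≤ 2 * r / 2 ^ n := by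
    intro w
    by_contra! hcon
    have hwr : ‖w‖ ≤ r := (hcon w).1
    have hfar : ∀ i ∈ I, 2 * r / 2 ^ n < ‖L (w - i)‖ := fun i hi => (hcon i).2 hi
    have hwI : w ∉ I := fun hw => by
      have := hfar w hw
      rw [sub_self, map_zero, norm_zero] at this
      linarith [show (0 : ℝ) ≤ 2 * r / 2 ^ n by positivity]
    have hins : Sep (insert w I) := by
      refine ⟨?_, ?_⟩
      · intro z hz
        rcases Finset.mem_insert.1 hz with rfl | hz
        · exact hwr
        · exact hI.1 z hz
      · intro z hz z' hz' hne
        rcases Finset.mem_insert.1 hz with rfl | hzI <;>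
          rcases Finset.mem_insert.1 hz' with rfl | hzI'
        · exact absurd rfl hne
        · exact hfar z' hzI'
        · rw [← norm_neg, ← map_neg, neg_sub]
          exact hfar z hzI
        · exact hI.2 z hzI z' hzI' hne
    have := hmax _ hins
    rw [Finset.card_insert_of_notMem hwI] at this
    omega
  choose i hi using hnear
  obtain ⟨e, he⟩ : ∃ e : E → Fin (2 ^ 4 ^ (n + 1)), Set.InjOn e I := by
    have hc : Fintype.card I ≤ Fintype.card (Fin (2 ^ 4 ^ (n + 1))) := by
      simpa using hbdd I hI
    obtain ⟨g⟩ := Function.Embedding.nonempty_of_card_le hc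
    refine ⟨fun w => if hw : w ∈ I then g ⟨w, hw⟩ else ⟨0, by positivity⟩, ?_⟩
    intro w hw w' hw' h
    simp only [Finset.mem_coe] at hw hw'
    simpa [hw, hw'] using h
  refine ⟨fun w => e (i w), fun w w' hw hw' hww => ?_⟩
  have hii := he (hi w hw).1 (hi w' hw').1 hww
  have h1 := (hi w hw).2
  have h2 := (hi w' hw').2
  rw [← hii] at h2
  have : L (w - w') = L (w - i w) - L (w' - i w) := by rw [← map_sub]; congr 1; abel
  rw [this]
  refine (norm_sub_le _ _).trans ?_
  calc _ ≤ 2 * r / 2 ^ n + 2 * r / 2 ^ n := add_le_add h1 h2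
    _ = _ := by ring

/-- The covering of Euclidean balls used in the entropy estimate, simultaneously in a weighted
`ℓ₂`-norm, at the dimension-free rate given by the Hilbert-Schmidt norm, and in the maximum norm,
at the cost of a factor `√(log m)`. -/
theorem exists_cover_weighted_and_max {m : ℕ} (hm : 2 ≤ m) (x : Fin m → E) (b : Fin m → ℝ)
    {R H r : ℝ} (hR : 0 < R) (hH : 0 < H) (hr : 0 < r) (hx : ∀ j, ‖x j‖ ≤ R)
    (hb : ∑ j, b j ^ 2 ≤ H) (n : ℕ) :
    ∃ c : E → Fin (2 ^ 4 ^ (n + 1)), ∀ w w', ‖w‖ ≤ r → ‖w'‖ ≤ r → c w = c w' →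
      ∑ j, b j ^ 2 * inner ℝ (x j) (w - w') ^ 2 ≤ (12 * r * R / 2 ^ n) ^ 2 * H ∧
      ∀ j, |inner ℝ (x j) (w - w')| ≤ 8 * r * R * √(2 * Real.log m) / 2 ^ n := by
  have hm0 : (0 : ℝ) < m := by positivity
  have hm2 : (2 : ℝ) ≤ m := by exact_mod_cast hm
  have hlog : 0 < Real.log m := Real.log_pos (by linarith)
  set α : ℝ := √(8 * R ^ 2 * H) with hα
  have hα0 : 0 < α := Real.sqrt_pos.2 (by positivity)
  have hα2 : α ^ 2 = 8 * R ^ 2 * H := Real.sq_sqrt (by positivity)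
  set l : ℝ := √(2 * Real.log m) with hl
  have hl0 : 0 < l := Real.sqrt_pos.2 (by positivity)
  have hl2 : l ^ 2 = 2 * Real.log m := Real.sq_sqrt (by positivity)
  set β : ℝ := 2 * R * l with hβ
  have hβ0 : 0 < β := by positivity
  let L : E →L[ℝ] EuclideanSpace ℝ (Fin m) × (Fin m → ℝ) :=
    LinearMap.toContinuousLinearMap
      (((WithLp.linearEquiv 2 ℝ (Fin m → ℝ)).symm.toLinearMap ∘ₗ
        LinearMap.pi fun j => (b j / α) • (innerₛₗ ℝ (x j))).prod
        (LinearMap.pi fun j => (1 / β) • (innerₛₗ ℝ (x j))))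
  have hL1 : ∀ w, ‖(L w).1‖ ^ 2 = (∑ j, b j ^ 2 * inner ℝ (x j) w ^ 2) / α ^ 2 := by
    intro w
    rw [EuclideanSpace.norm_sq_eq, Finset.sum_div]
    refine Finset.sum_congr rfl fun j _ => ?_
    change ‖b j / α * inner ℝ (x j) w‖ ^ 2 = _
    rw [Real.norm_eq_abs, sq_abs]
    ring
  have hL2 : ∀ w j, (L w).2 j = inner ℝ (x j) w / β := by
    intro w j
    change 1 / β * inner ℝ (x j) w = _
    ring
  -- exponential majorant of the indicator of the complement of the unit ball
  let g : E → ℝ := fun w => ∑ j, b j ^ 2 / (8 * H) *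
      (Real.exp (-‖w‖ ^ 2 / 2) * (Real.exp (inner ℝ ((1 / R) • x j) w)
        + Real.exp (-inner ℝ ((1 / R) • x j) w)) - 2 * Real.exp (-‖w‖ ^ 2 / 2))
    + ∑ j, Real.exp (-(2 * l) ^ 2) * (Real.exp (-‖w‖ ^ 2 / 2) *
        (Real.exp (inner ℝ ((2 * l / R) • x j) w) + Real.exp (-inner ℝ ((2 * l / R) • x j) w)))
  set Z := ∫ x : E, Real.exp (-‖x‖ ^ 2 / 2) with hZ
  have hZ0 : 0 < Z := integral_gaussian_pos
  have hcosh : ∀ t : ℝ, t ^ 2 ≤ Real.exp t + Real.exp (-t) - 2 := by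
    intro t
    have h1 := Real.cosh_sq (t / 2)
    have h2 := Real.cosh_two_mul (t / 2)
    rw [show 2 * (t / 2) = t by ring, Real.cosh_eq] at h2
    have h3 : (t / 2) ^ 2 ≤ Real.sinh (t / 2) ^ 2 := by
      rw [← sq_abs (t / 2), ← sq_abs (Real.sinh (t / 2)), Real.abs_sinh]
      exact pow_le_pow_left₀ (abs_nonneg _) (Real.self_le_sinh_iff.2 (abs_nonneg _)) 2
    nlinarith
  have hterm1 : ∀ w j, Real.exp (-‖w‖ ^ 2 / 2) * (b j ^ 2 * inner ℝ (x j) w ^ 2 / α ^ 2)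
      ≤ b j ^ 2 / (8 * H) * (Real.exp (-‖w‖ ^ 2 / 2) * (Real.exp (inner ℝ ((1 / R) • x j) w)
        + Real.exp (-inner ℝ ((1 / R) • x j) w)) - 2 * Real.exp (-‖w‖ ^ 2 / 2)) := by
    intro w j
    have h := hcosh (inner ℝ ((1 / R) • x j) w)
    have e : b j ^ 2 * inner ℝ (x j) w ^ 2 / α ^ 2
        = b j ^ 2 / (8 * H) * inner ℝ ((1 / R) • x j) w ^ 2 := by
      rw [hα2, inner_smul_left]
      simp only [conj_trivial]
      field_simp
    rw [e]
    calc _ = b j ^ 2 / (8 * H) * (Real.exp (-‖w‖ ^ 2 / 2) * inner ℝ ((1 / R) • x j) w ^ 2) := by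
          ring
      _ ≤ b j ^ 2 / (8 * H) * (Real.exp (-‖w‖ ^ 2 / 2) * (Real.exp (inner ℝ ((1 / R) • x j) w)
        + Real.exp (-inner ℝ ((1 / R) • x j) w) - 2)) := by gcongr
      _ = _ := by ring
  have hg0a : ∀ w, 0 ≤ ∑ j, b j ^ 2 / (8 * H) *
      (Real.exp (-‖w‖ ^ 2 / 2) * (Real.exp (inner ℝ ((1 / R) • x j) w)
        + Real.exp (-inner ℝ ((1 / R) • x j) w)) - 2 * Real.exp (-‖w‖ ^ 2 / 2)) := fun w =>
    Finset.sum_nonneg fun j _ => le_trans (by positivity) (hterm1 w j)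
  have hgi1 : ∀ j, Integrable fun w : E => b j ^ 2 / (8 * H) *
      (Real.exp (-‖w‖ ^ 2 / 2) * (Real.exp (inner ℝ ((1 / R) • x j) w)
        + Real.exp (-inner ℝ ((1 / R) • x j) w)) - 2 * Real.exp (-‖w‖ ^ 2 / 2)) := fun j =>
    ((integral_gaussian_mul_cosh_inner _).1.sub (integrable_gaussian.const_mul 2)).const_mul _
  have hgi2 : ∀ j, Integrable fun w : E => Real.exp (-(2 * l) ^ 2) * (Real.exp (-‖w‖ ^ 2 / 2) *
      (Real.exp (inner ℝ ((2 * l / R) • x j) w) + Real.exp (-inner ℝ ((2 * l / R) • x j) w))) :=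
    fun j => (integral_gaussian_mul_cosh_inner _).1.const_mul _
  have hgi : Integrable g :=
    (integrable_finsetSum _ fun j _ => hgi1 j).add (integrable_finsetSum _ fun j _ => hgi2 j)
  have hgint : ∫ w, g w ≤ Z / 2 := by
    simp only [g]
    rw [integral_add (integrable_finsetSum _ fun j _ => hgi1 j)
      (integrable_finsetSum _ fun j _ => hgi2 j), integral_finsetSum _ fun j _ => hgi1 j,
      integral_finsetSum _ fun j _ => hgi2 j]
    have a1 : ∀ j, ∫ w : E, b j ^ 2 / (8 * H) *
      (Real.exp (-‖w‖ ^ 2 / 2) * (Real.exp (inner ℝ ((1 / R) • x j) w)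
        + Real.exp (-inner ℝ ((1 / R) • x j) w)) - 2 * Real.exp (-‖w‖ ^ 2 / 2))
        ≤ b j ^ 2 / (8 * H) * (2 * Z) := by
      intro j
      rw [integral_const_mul, integral_sub (integral_gaussian_mul_cosh_inner _).1
        (integrable_gaussian.const_mul 2), (integral_gaussian_mul_cosh_inner _).2,
        integral_const_mul]
      have hn : ‖(1 / R) • x j‖ ^ 2 ≤ 1 := by
        rw [norm_smul, Real.norm_eq_abs, abs_of_pos (by positivity)]
        have : 1 / R * ‖x j‖ ≤ 1 := by
          rw [one_div, inv_mul_le_iff₀ hR]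
          simpa using hx j
        exact pow_le_one₀ (by positivity) this
      have he : Real.exp (‖(1 / R) • x j‖ ^ 2 / 2) ≤ 2 := by
        have h1 := Real.exp_one_lt_d9
        have h2 : Real.exp (1 / 2) ^ 2 = Real.exp 1 := by rw [← Real.exp_nat_mul]; norm_num
        have h3 : Real.exp (‖(1 / R) • x j‖ ^ 2 / 2) ≤ Real.exp (1 / 2) := by gcongr
        nlinarith [Real.exp_pos (1 / 2 : ℝ)]
      gcongr
      nlinarith
    have a2 : ∀ j, ∫ w : E, Real.exp (-(2 * l) ^ 2) * (Real.exp (-‖w‖ ^ 2 / 2) *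
        (Real.exp (inner ℝ ((2 * l / R) • x j) w) + Real.exp (-inner ℝ ((2 * l / R) • x j) w)))
        ≤ 1 / m * (1 / 4 * Z) := by
      intro j
      rw [integral_const_mul, (integral_gaussian_mul_cosh_inner _).2]
      have hn : ‖(2 * l / R) • x j‖ ^ 2 ≤ (2 * l) ^ 2 := by
        rw [norm_smul, Real.norm_eq_abs, abs_of_pos (by positivity)]
        refine pow_le_pow_left₀ (by positivity) ?_ 2
        rw [div_mul_eq_mul_div, div_le_iff₀ hR]
        gcongr
        exact hx j
      have hexp : Real.exp (-(2 * l) ^ 2) * Real.exp (‖(2 * l / R) • x j‖ ^ 2 / 2)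
          ≤ 1 / m ^ 4 := by
        rw [← Real.exp_add]
        calc _ ≤ Real.exp (-(2 * l) ^ 2 + (2 * l) ^ 2 / 2) := by gcongr
          _ = Real.exp (-(4 * Real.log m)) := by
              congr 1
              rw [mul_pow, hl2]
              ring
          _ = _ := by
              rw [Real.exp_neg, one_div, show (4 : ℝ) * Real.log m = (4 : ℕ) * Real.log m by norm_num,
                Real.exp_nat_mul, Real.exp_log hm0]
      have hm3 : (8 : ℝ) ≤ m ^ 3 := by
        calc (8 : ℝ) = 2 ^ 3 := by norm_num
          _ ≤ _ := by gcongr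
      calc _ = 2 * (Real.exp (-(2 * l) ^ 2) * Real.exp (‖(2 * l / R) • x j‖ ^ 2 / 2)) * Z := by ring
        _ ≤ 2 * (1 / m ^ 4) * Z := by gcongr
        _ = 1 / m * (2 / m ^ 3 * Z) := by field_simp
        _ ≤ _ := by
          have : 2 / (m : ℝ) ^ 3 ≤ 1 / 4 := by
            rw [div_le_iff₀ (by positivity)]
            linarith
          gcongr
    have b1 : ∑ j, b j ^ 2 / (8 * H) * (2 * Z) ≤ Z / 4 := by
      rw [← Finset.sum_mul, ← Finset.sum_div]
      calc _ ≤ H / (8 * H) * (2 * Z) := by gcongr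
        _ = _ := by field_simp; ring
    have b2 : ∑ _j : Fin m, 1 / (m : ℝ) * (1 / 4 * Z) = Z / 4 := by
      rw [Finset.sum_const, nsmul_eq_mul, Finset.card_univ, Fintype.card_fin]
      field_simp
    have c1 := (Finset.sum_le_sum fun j (_ : j ∈ Finset.univ) => a1 j).trans b1
    have c2 := (Finset.sum_le_sum fun j (_ : j ∈ Finset.univ) => a2 j).trans b2.le
    linarith
  set S : Set E := {w : E | ‖L w‖ ≤ 1} with hSdef
  have hS : MeasurableSet S := (isClosed_le (by fun_prop) continuous_const).measurableSet
  have hbad : ∀ w ∈ Sᶜ, Real.exp (-‖w‖ ^ 2 / 2) ≤ g w := by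
    intro w hw
    have hw1 : 1 < ‖L w‖ := not_le.1 hw
    rw [Prod.norm_def, lt_max_iff] at hw1
    rcases hw1 with h | h
    · have h2 : 1 ≤ ‖(L w).1‖ ^ 2 := one_le_pow₀ h.le
      rw [hL1, Finset.sum_div] at h2
      have h3 : Real.exp (-‖w‖ ^ 2 / 2) ≤ ∑ j, Real.exp (-‖w‖ ^ 2 / 2) *
          (b j ^ 2 * inner ℝ (x j) w ^ 2 / α ^ 2) := by
        rw [← Finset.mul_sum]
        exact le_mul_of_one_le_right (by positivity) h2
      refine h3.trans ((Finset.sum_le_sum fun j _ => hterm1 w j).trans ?_)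
      exact le_add_of_nonneg_right (by positivity)
    · obtain ⟨j, hj⟩ : ∃ j, 1 < |inner ℝ (x j) w / β| := by
        by_contra! hcon
        refine absurd h (not_lt.2 ((pi_norm_le_iff_of_nonneg zero_le_one).2 fun j => ?_))
        rw [hL2, Real.norm_eq_abs]
        exact hcon j
      refine le_add_of_nonneg_of_le (hg0a w) ?_
      refine le_trans ?_ (Finset.single_le_sum (f := fun j => Real.exp (-(2 * l) ^ 2) *
        (Real.exp (-‖w‖ ^ 2 / 2) * (Real.exp (inner ℝ ((2 * l / R) • x j) w)
          + Real.exp (-inner ℝ ((2 * l / R) • x j) w)))) (fun j _ => by positivity)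
        (Finset.mem_univ j))
      have hbig : (2 * l) ^ 2 ≤ |inner ℝ ((2 * l / R) • x j) w| := by
        rw [abs_div, abs_of_pos hβ0, lt_div_iff₀ hβ0] at hj
        rw [inner_smul_left]
        simp only [conj_trivial]
        rw [abs_mul, abs_of_pos (show 0 < 2 * l / R by positivity)]
        calc (2 * l) ^ 2 = 2 * l / R * (1 * β) := by rw [hβ]; field_simp
          _ ≤ _ := by gcongr
      have hone : Real.exp ((2 * l) ^ 2) ≤ Real.exp (inner ℝ ((2 * l / R) • x j) w)
          + Real.exp (-inner ℝ ((2 * l / R) • x j) w) := by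
        refine (Real.exp_le_exp.2 hbig).trans ?_
        rcases abs_choice (inner ℝ ((2 * l / R) • x j) w) with h | h <;> rw [h]
        · exact le_add_of_nonneg_right (by positivity)
        · exact le_add_of_nonneg_left (by positivity)
      calc Real.exp (-‖w‖ ^ 2 / 2)
          = Real.exp (-(2 * l) ^ 2) * (Real.exp (-‖w‖ ^ 2 / 2) * Real.exp ((2 * l) ^ 2)) := by
            rw [mul_left_comm, ← Real.exp_add]
            simp
        _ ≤ _ := by gcongr
  have hg0 : ∀ w, 0 ≤ g w := fun w => add_nonneg (hg0a w) (by positivity)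
  have hhalf : Z / 2 ≤ ∫ w in S, Real.exp (-‖w‖ ^ 2 / 2) := by
    have h1 := integral_add_compl hS (integrable_gaussian (E := E))
    have h2 : ∫ w in Sᶜ, Real.exp (-‖w‖ ^ 2 / 2) ≤ ∫ w in Sᶜ, g w :=
      setIntegral_mono_on integrable_gaussian.integrableOn hgi.integrableOn hS.compl hbad
    have h3 : ∫ w in Sᶜ, g w ≤ ∫ w, g w :=
      setIntegral_le_integral hgi (Filter.Eventually.of_forall hg0)
    linarith
  obtain ⟨c, hc⟩ := exists_cover_of_gaussian L hhalf hr n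
  refine ⟨c, fun w w' hw hw' hww => ?_⟩
  have hLw := hc w w' hw hw' hww
  rw [Prod.norm_def, max_le_iff] at hLw
  refine ⟨?_, fun j => ?_⟩
  · have h1 := pow_le_pow_left₀ (norm_nonneg _) hLw.1 2
    rw [hL1, div_le_iff₀ (by positivity), hα2] at h1
    refine h1.trans ?_
    have : (12 * r * R / 2 ^ n) ^ 2 * H = (4 * r / 2 ^ n) ^ 2 * (9 * R ^ 2 * H) := by ring
    rw [this]
    gcongr
    norm_num
  · have h1 := (norm_le_pi_norm (L (w - w')).2 j).trans hLw.2
    rw [hL2, Real.norm_eq_abs, abs_div, abs_of_pos hβ0, div_le_iff₀ hβ0] at h1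
    refine h1.trans (le_of_eq ?_)
    rw [hβ]
    ring

end Gaussian

/-! ### The signed power -/

/-- The odd extension `t ↦ sign t * |t| ^ p` of the power function. It dominates `|t| ^ p` as far
as increments are concerned and, unlike `|t| ^ p`, is monotone, so that midpoints are not far away
in the metric it defines. -/
noncomputable def signedPow (p t : ℝ) : ℝ := t * |t| ^ (p - 1)

section SignedPow

variable {p : ℝ}

theorem abs_signedPow (hp : 1 < p) (t : ℝ) : |signedPow p t| = |t| ^ p := by
  rw [signedPow, abs_mul, abs_of_nonneg (Real.rpow_nonneg (abs_nonneg t) _)]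
  rcases eq_or_ne t 0 with rfl | ht
  · rw [abs_zero, zero_mul, Real.zero_rpow (by linarith)]
  · rw [Real.rpow_sub_one (abs_ne_zero.2 ht)]
    field_simp

theorem continuous_signedPow (hp : 1 < p) : Continuous (signedPow p) :=
  continuous_id.mul (continuous_abs.rpow_const fun _ => Or.inr (by linarith))

theorem abs_rpow_sub_rpow_le_signedPow (hp : 1 < p) (s t : ℝ) :
    |(|s| ^ p - |t| ^ p)| ≤ |signedPow p s - signedPow p t| := by
  rw [← abs_signedPow hp, ← abs_signedPow hp]
  exact abs_abs_sub_abs_le _ _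

theorem monotone_signedPow (hp : 1 < p) : Monotone (signedPow p) := by
  intro s t hst
  unfold signedPow
  have h0 : 0 ≤ p - 1 := by linarith
  rcases le_total 0 s with hs | hs
  · have ht : 0 ≤ t := hs.trans hst
    rw [abs_of_nonneg hs, abs_of_nonneg ht]
    gcongr
  · rcases le_total 0 t with ht | ht
    · exact (mul_nonpos_of_nonpos_of_nonneg hs (by positivity)).trans (by positivity)
    · have : |t| ^ (p - 1) ≤ |s| ^ (p - 1) := by
        apply Real.rpow_le_rpow (abs_nonneg t) _ h0
        rw [abs_of_nonpos hs, abs_of_nonpos ht]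
        linarith
      calc s * |s| ^ (p - 1) ≤ t * |s| ^ (p - 1) := by gcongr
        _ ≤ t * |t| ^ (p - 1) := mul_le_mul_of_nonpos_left this ht

theorem signedPow_midpoint (hp : 1 < p) (s t : ℝ) :
    |signedPow p s - signedPow p ((s + t) / 2)| ≤ |signedPow p s - signedPow p t| := by
  have hm := monotone_signedPow hp
  rcases le_total s t with h | h
  · have h1 := hm (show s ≤ (s + t) / 2 by linarith)
    have h2 := hm (show (s + t) / 2 ≤ t by linarith)
    rw [abs_of_nonpos (by linarith), abs_of_nonpos (by linarith)]
    linarith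
  · have h1 := hm (show (s + t) / 2 ≤ s by linarith)
    have h2 := hm (show t ≤ (s + t) / 2 by linarith)
    rw [abs_of_nonneg (by linarith), abs_of_nonneg (by linarith)]
    linarith

theorem rpow_sub_rpow_le {r s t : ℝ} (hr : 1 ≤ r) (ht : 0 ≤ t) (hts : t ≤ s) :
    s * (s ^ r - t ^ r) ≤ r * (s - t) * s ^ r := by
  rcases (ht.trans hts).eq_or_lt with rfl | hs
  · have : t = 0 := le_antisymm hts ht
    subst this
    simp
  · have h := one_add_mul_self_le_rpow_one_add (s := (t - s) / s)
      (by rw [le_div_iff₀ hs]; linarith) hr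
    rw [show 1 + (t - s) / s = t / s by field_simp; ring, Real.div_rpow ht hs.le,
      le_div_iff₀ (by positivity)] at h
    have : s * ((1 + r * ((t - s) / s)) * s ^ r) = s * s ^ r - r * (s - t) * s ^ r := by
      field_simp
      ring
    nlinarith

theorem abs_signedPow_sub_le (hp : 2 ≤ p) (s t : ℝ) :
    |signedPow p s - signedPow p t| ≤ p * |s - t| * max |s| |t| ^ (p - 1) := by
  wlog h : |t| ≤ |s| generalizing s t
  · rw [abs_sub_comm, abs_sub_comm s, max_comm]
    exact this t s (le_of_not_ge h)
  rw [max_eq_left h]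
  have hs0 := abs_nonneg s
  have ht0 := abs_nonneg t
  have e : signedPow p s - signedPow p t
      = (s - t) * |s| ^ (p - 1) + t * (|s| ^ (p - 1) - |t| ^ (p - 1)) := by
    unfold signedPow
    ring
  have hmono : |t| ^ (p - 1) ≤ |s| ^ (p - 1) := Real.rpow_le_rpow ht0 h (by linarith)
  have h1 := rpow_sub_rpow_le (r := p - 1) (by linarith) ht0 h
  have h2 : |t| * (|s| ^ (p - 1) - |t| ^ (p - 1)) ≤ (p - 1) * |s - t| * |s| ^ (p - 1) := by
    calc _ ≤ |s| * (|s| ^ (p - 1) - |t| ^ (p - 1)) := by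
          apply mul_le_mul_of_nonneg_right h; linarith
      _ ≤ _ := h1
      _ ≤ _ := by
          have := abs_sub_abs_le_abs_sub s t
          have : 0 ≤ p - 1 := by linarith
          gcongr
  rw [e]
  refine (abs_add_le _ _).trans ?_
  rw [abs_mul, abs_mul, abs_of_nonneg (show 0 ≤ |s| ^ (p - 1) by positivity),
    abs_of_nonneg (show 0 ≤ |s| ^ (p - 1) - |t| ^ (p - 1) by linarith)]
  linarith

end SignedPow

/-! ### Penalized projections -/

section Penalized

variable {E V : Type*} [PseudoMetricSpace V]

theorem exists_penalized_minimizer [TopologicalSpace E] {K : Set E} (hK : IsCompact K)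
    (hne : K.Nonempty) {g : E → ℝ} (hg : Continuous g) {F : E → V} (hF : Continuous F) (t : ℝ) :
    ∃ π : E → E, ∀ x, π x ∈ K ∧
      ∀ w ∈ K, g (π x) + t * dist (F x) (F (π x)) ≤ g w + t * dist (F x) (F w) := by
  have : ∀ x, ∃ y ∈ K, ∀ w ∈ K, g y + t * dist (F x) (F y) ≤ g w + t * dist (F x) (F w) := by
    intro x
    obtain ⟨y, hy, hmin⟩ := hK.exists_isMinOn hne
      (f := fun w => g w + t * dist (F x) (F w)) (by fun_prop)
    exact ⟨y, hy, fun w hw => hmin hw⟩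
  choose π hπ using this
  exact ⟨π, hπ⟩

/-- Interpolation: for the minimizers `π n x` of `g + τ * 2 ^ n * dist (F x) (F ·)`, the minimal
value increases with `n` by at least `τ * 2 ^ n * dist (F x) (F (π n x)) / 2` and never exceeds
`g x`. -/
theorem sum_dist_penalized_le {K : Set E} {g : E → ℝ} {F : E → V} {τ : ℝ} (hτ : 0 < τ)
    (hg0 : ∀ x, 0 ≤ g x) {π : ℕ → E → E}
    (hπ : ∀ n x, π n x ∈ K ∧ ∀ w ∈ K, g (π n x) + τ * 2 ^ n * dist (F x) (F (π n x))
      ≤ g w + τ * 2 ^ n * dist (F x) (F w)) {x : E} (hx : x ∈ K) (hgx : g x ≤ 1) (N : ℕ) :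
    ∑ n ∈ Finset.range (N + 1), 2 ^ n * dist (F x) (F (π n x)) ≤ 2 / τ := by
  have hind : ∀ N, ∑ n ∈ Finset.range (N + 1), τ * (2 ^ n * dist (F x) (F (π n x))) / 2
      ≤ g (π N x) + τ * 2 ^ N * dist (F x) (F (π N x)) := by
    intro N
    induction N with
    | zero =>
      have h1 := hg0 (π 0 x)
      have h2 : 0 ≤ τ * dist (F x) (F (π 0 x)) := by positivity
      simp only [zero_add, Finset.sum_range_one, pow_zero, mul_one, one_mul]
      linarith
    | succ N ih =>
      rw [Finset.sum_range_succ]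
      have h := (hπ N x).2 _ (hπ (N + 1) x).1
      rw [pow_succ]
      linarith
  have h1 := (hind N).trans ((hπ N x).2 x hx)
  rw [dist_self, mul_zero, add_zero, ← Finset.sum_div, ← Finset.mul_sum] at h1
  rw [le_div_iff₀ hτ]
  linarith

end Penalized

/-! ### Symmetric convex bodies -/

section Body

variable {E : Type*} [NormedAddCommGroup E] [NormedSpace ℝ E] {K : Set E}

theorem IsSymmConvexBody.zero_mem_nhds (hK : IsSymmConvexBody K) : K ∈ nhds (0 : E) := by
  obtain ⟨z, hz⟩ := hK.nonempty_interior
  have hz' : -z ∈ K := hK.neg_mem z (interior_subset hz)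
  have := hK.convex.combo_interior_self_mem_interior hz hz' (a := 1 / 2) (b := 1 / 2)
    (by norm_num) (by norm_num) (by norm_num)
  rw [smul_neg, add_neg_cancel] at this
  exact mem_interior_iff_mem_nhds.1 this

theorem IsSymmConvexBody.zero_mem (hK : IsSymmConvexBody K) : (0 : E) ∈ K :=
  mem_of_mem_nhds hK.zero_mem_nhds

theorem IsSymmConvexBody.gauge_sub_le_two (hK : IsSymmConvexBody K) {y z : E} (hy : y ∈ K)
    (hz : z ∈ K) : gauge K (y - z) ≤ 2 := by
  rw [sub_eq_add_neg]
  refine (gauge_add_le hK.convex (absorbent_nhds_zero hK.zero_mem_nhds) _ _).trans ?_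
  rw [gauge_neg hK.neg_mem]
  linarith [gauge_le_one_of_mem hy, gauge_le_one_of_mem hz]

theorem IsSymmConvexBody.mem_smul_of_gauge_le (hK : IsSymmConvexBody K) {y : E} {ρ : ℝ}
    (hρ : 0 < ρ) (hy : gauge K y ≤ ρ) : ∃ k ∈ K, y = ρ • k := by
  refine ⟨ρ⁻¹ • y, ?_, by rw [smul_smul, mul_inv_cancel₀ hρ.ne', one_smul]⟩
  have h1 : gauge K (ρ⁻¹ • y) ≤ 1 := by
    rw [gauge_smul_of_nonneg (by positivity), smul_eq_mul, inv_mul_le_iff₀ hρ]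
    linarith
  have := (gauge_le_one_iff_mem_closure hK.convex hK.zero_mem_nhds).1 h1
  rwa [hK.isCompact.isClosed.closure_eq] at this

theorem HasPowerTypeConvexity.one_le [Nontrivial E] {q lam : ℝ} (hK : IsSymmConvexBody K)
    (hq : 0 < q) (hlam : 0 < lam) (h : HasPowerTypeConvexity K q lam) : 1 ≤ lam := by
  obtain ⟨y, hy⟩ := exists_ne (0 : E)
  have hpos : 0 < gauge K y :=
    (gauge_pos (absorbent_nhds_zero hK.zero_mem_nhds)
      (hK.isCompact.isVonNBounded ℝ)).2 hy
  have h1 := h y (-y)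
  rw [add_neg_cancel, smul_zero, gauge_zero, gauge_neg hK.neg_mem, Real.zero_rpow hq.ne',
    sub_neg_eq_add, ← two_smul ℝ, smul_smul] at h1
  norm_num at h1
  have h2 : lam ^ (-q) ≤ 1 := by
    have : 0 < gauge K y ^ q := by positivity
    nlinarith
  by_contra! hlt
  exact absurd h2 (not_le.2 (Real.one_lt_rpow_of_pos_of_lt_one_of_neg hlam hlt (by linarith)))

/-- The minimizers of a penalized functional `gauge K ^ q + t * dist (F x) (F ·)` are close to each
other in the norm of `K` when their `F`-images are: by power type convexity their midpoint would
otherwise be a better competitor. -/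
theorem HasPowerTypeConvexity.gauge_sub_le {V : Type*} [PseudoMetricSpace V] {F : E → V}
    {q lam t Δ : ℝ} (hK : IsSymmConvexBody K) (hq : 0 < q) (hlam : 1 ≤ lam)
    (h : HasPowerTypeConvexity K q lam) (ht : 0 ≤ t)
    (hF : ∀ u v, dist (F u) (F ((1 / 2 : ℝ) • (u + v))) ≤ dist (F u) (F v)) {x x' u v : E}
    (hu : u ∈ K) (hv : v ∈ K)
    (hxu : ∀ w ∈ K, gauge K u ^ q + t * dist (F x) (F u) ≤ gauge K w ^ q + t * dist (F x) (F w))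
    (hxv : ∀ w ∈ K, gauge K v ^ q + t * dist (F x') (F v) ≤ gauge K w ^ q + t * dist (F x') (F w))
    (hΔ : dist (F u) (F v) ≤ Δ) :
    gauge K (u - v) ≤ 2 * lam * (min 1 (t * Δ)) ^ (1 / q) := by
  have hΔ0 : 0 ≤ Δ := dist_nonneg.trans hΔ
  set w : E := (1 / 2 : ℝ) • (u + v) with hw
  have hwK : w ∈ K := by
    rw [hw, smul_add]
    exact hK.convex hu hv (by norm_num) (by norm_num) (by norm_num)
  have h1 := hxu w hwK
  have h2 := hxv w hwK
  have d1 : dist (F x) (F w) ≤ dist (F x) (F u) + Δ :=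
    (dist_triangle _ (F u) _).trans (by gcongr; exact (hF u v).trans hΔ)
  have d2 : dist (F x') (F w) ≤ dist (F x') (F v) + Δ := by
    refine (dist_triangle _ (F v) _).trans ?_
    gcongr
    rw [hw, add_comm u v]
    exact (hF v u).trans (by rwa [dist_comm])
  have h3 := h u v
  rw [← hw] at h3
  have hg : gauge K ((1 / 2 : ℝ) • (u - v)) = gauge K (u - v) / 2 := by
    rw [gauge_smul_of_nonneg (by norm_num), smul_eq_mul]
    ring
  set γ := gauge K ((1 / 2 : ℝ) • (u - v)) with hγ
  have hγ0 : 0 ≤ γ := gauge_nonneg _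
  have hγ1 : γ ≤ 1 := by
    rw [hg]
    linarith [hK.gauge_sub_le_two hu hv]
  have hlam0 : 0 < lam := by linarith
  have h4 : lam ^ (-q) * γ ^ q ≤ t * Δ := by
    have := mul_le_mul_of_nonneg_left d1 ht
    have := mul_le_mul_of_nonneg_left d2 ht
    linarith
  have h5 : (γ / lam) ^ q ≤ min 1 (t * Δ) := by
    rw [Real.div_rpow hγ0 hlam0.le]
    refine le_min ?_ ?_
    · rw [div_le_one (by positivity)]
      exact Real.rpow_le_rpow hγ0 (hγ1.trans hlam) hq.le
    · rw [Real.rpow_neg hlam0.le] at h4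
      rwa [div_eq_inv_mul]
  have h6 : γ / lam ≤ (min 1 (t * Δ)) ^ (1 / q) := by
    have := Real.rpow_le_rpow (by positivity) h5 (show 0 ≤ 1 / q by positivity)
    rwa [← Real.rpow_mul (by positivity), mul_one_div_cancel hq.ne', Real.rpow_one] at this
  rw [div_le_iff₀ hlam0] at h6
  linarith

end Body

/-! ### The entropy estimate -/

section Entropy

variable {E : Type*} [NormedAddCommGroup E] [InnerProductSpace ℝ E] {m : ℕ}

/-- The embedding of `E` into Euclidean space by signed powers of the functionals `⟨x j, ·⟩`. Its
metric dominates the increments of the Rademacher process `∑ ε j * |⟨x j, ·⟩| ^ p`. -/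
noncomputable def powerMap (p : ℝ) (x : Fin m → E) (y : E) : EuclideanSpace ℝ (Fin m) :=
  WithLp.toLp 2 fun j => signedPow p (inner ℝ (x j) y)

theorem dist_powerMap (p : ℝ) (x : Fin m → E) (y z : E) :
    dist (powerMap p x y) (powerMap p x z) =
      √(∑ j, (signedPow p (inner ℝ (x j) y) - signedPow p (inner ℝ (x j) z)) ^ 2) := by
  rw [EuclideanSpace.dist_eq]
  congr 1
  refine Finset.sum_congr rfl fun j _ => ?_
  rw [Real.dist_eq, sq_abs]
  rfl

theorem continuous_powerMap {p : ℝ} (hp : 1 < p) (x : Fin m → E) : Continuous (powerMap p x) := by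
  refine (PiLp.continuous_toLp 2 _).comp (continuous_pi fun j => ?_)
  exact (continuous_signedPow hp).comp (by fun_prop)

theorem dist_powerMap_midpoint {p : ℝ} (hp : 1 < p) (x : Fin m → E) (u v : E) :
    dist (powerMap p x u) (powerMap p x ((1 / 2 : ℝ) • (u + v)))
      ≤ dist (powerMap p x u) (powerMap p x v) := by
  rw [dist_powerMap, dist_powerMap]
  apply Real.sqrt_le_sqrt
  refine Finset.sum_le_sum fun j _ => sq_le_sq.2 ?_
  have : inner ℝ (x j) ((1 / 2 : ℝ) • (u + v)) = (inner ℝ (x j) u + inner ℝ (x j) v) / 2 := by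
    rw [inner_smul_right, inner_add_right]
    ring
  rw [this]
  exact signedPow_midpoint hp _ _

theorem sqrt_sum_le_dist_powerMap {p : ℝ} (hp : 1 < p) (x : Fin m → E) (y z : E) :
    √(∑ j, (|inner ℝ (x j) y| ^ p - |inner ℝ (x j) z| ^ p) ^ 2)
      ≤ dist (powerMap p x y) (powerMap p x z) := by
  rw [dist_powerMap]
  apply Real.sqrt_le_sqrt
  exact Finset.sum_le_sum fun j _ => sq_le_sq.2 (abs_rpow_sub_rpow_le_signedPow hp _ _)

theorem abs_inner_le_of_subset_closedBall {K : Set E} {D R : ℝ} (hD : K ⊆ Metric.closedBall 0 D)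
    {x y : E} (hx : ‖x‖ ≤ R) (hy : y ∈ K) : |inner ℝ x y| ≤ D * R := by
  refine (abs_real_inner_le_norm x y).trans ?_
  rw [mul_comm]
  have : ‖y‖ ≤ D := by simpa using hD hy
  have hD0 : 0 ≤ D := (norm_nonneg y).trans this
  gcongr

theorem sum_rpow_inner_le {K : Set E} {D R M p s : ℝ} (hs : 0 ≤ s) (hp : 0 < p)
    (hD : K ⊆ Metric.closedBall 0 D) (hR0 : 0 ≤ R) (hD0 : 0 ≤ D) {x : Fin m → E}
    (hx : ∀ j, ‖x j‖ ≤ R)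
    (hM : ∀ y ∈ K, ∑ j, |inner ℝ (x j) y| ^ p ≤ M) {y : E} (hy : y ∈ K) :
    ∑ j, |inner ℝ (x j) y| ^ (s + p) ≤ (D * R) ^ s * M := by
  calc _ ≤ ∑ j, (D * R) ^ s * |inner ℝ (x j) y| ^ p := by
        refine Finset.sum_le_sum fun j _ => ?_
        rw [Real.rpow_add_of_nonneg (abs_nonneg _) hs hp.le]
        have := abs_inner_le_of_subset_closedBall hD (hx j) hy
        gcongr
    _ ≤ _ := by
        rw [← Finset.mul_sum]
        gcongr
        exact hM y hy

theorem dist_powerMap_le_diam {K : Set E} {D R M p : ℝ} (hp : 1 < p)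
    (hD : K ⊆ Metric.closedBall 0 D) (hR0 : 0 ≤ R) (hD0 : 0 ≤ D) {x : Fin m → E}
    (hx : ∀ j, ‖x j‖ ≤ R) (hM : ∀ y ∈ K, ∑ j, |inner ℝ (x j) y| ^ p ≤ M) {y z : E}
    (hy : y ∈ K) (hz : z ∈ K) :
    dist (powerMap p x y) (powerMap p x z) ≤ 2 * ((D * R) ^ (p / 2) * √M) := by
  have h1 : ∀ y ∈ K, dist (powerMap p x y) 0 ≤ (D * R) ^ (p / 2) * √M := by
    intro y hy
    have hDR : 0 ≤ D * R := by positivity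
    rw [dist_zero_right, EuclideanSpace.norm_eq]
    have : (D * R) ^ (p / 2) * √M = √((D * R) ^ p * M) := by
      rw [Real.sqrt_mul (by positivity), Real.sqrt_eq_rpow ((D * R) ^ p), ← Real.rpow_mul hDR]
      ring_nf
    rw [this]
    apply Real.sqrt_le_sqrt
    refine le_trans (le_of_eq ?_) (sum_rpow_inner_le (by linarith : 0 ≤ p) (by linarith) hD hR0 hD0
      hx hM hy)
    refine Finset.sum_congr rfl fun j _ => ?_
    change ‖signedPow p (inner ℝ (x j) y)‖ ^ 2 = _
    rw [Real.norm_eq_abs, abs_signedPow hp, Real.rpow_add_of_nonneg (abs_nonneg _) (by linarith)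
      (by linarith), sq]
  calc _ ≤ dist (powerMap p x y) 0 + dist (powerMap p x z) 0 := dist_triangle_right _ _ _
    _ ≤ _ := by linarith [h1 y hy, h1 z hz]

theorem add_add_rpow_le {a b c r : ℝ} (ha : 0 ≤ a) (hb : 0 ≤ b) (hc : 0 ≤ c) (hr : 0 ≤ r) :
    (a + max b c) ^ r ≤ 2 ^ r * (a ^ r + b ^ r + c ^ r) := by
  have h1 : a + max b c ≤ 2 * max a (max b c) := by
    have := le_max_left a (max b c)
    have := le_max_right a (max b c)
    linarith
  have h2 : (max a (max b c)) ^ r ≤ a ^ r + b ^ r + c ^ r := by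
    have ha' : 0 ≤ a ^ r := by positivity
    have hb' : 0 ≤ b ^ r := by positivity
    have hc' : 0 ≤ c ^ r := by positivity
    rcases max_choice a (max b c) with h | h <;> rw [h]
    · linarith
    · rcases max_choice b c with h | h <;> rw [h] <;> linarith
  calc _ ≤ (2 * max a (max b c)) ^ r := Real.rpow_le_rpow (by positivity) h1 hr
    _ = 2 ^ r * (max a (max b c)) ^ r := Real.mul_rpow (by norm_num) (by positivity)
    _ ≤ _ := by gcongr

/-- Local Lipschitz bound for `powerMap` near `u`, in terms of the Euclidean norm with weights
`|⟨x j, u⟩| ^ (p - 1)` and of the maximum norm. -/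
theorem sum_signedPow_sub_sq_le {p : ℝ} (hp : 2 ≤ p) (x : Fin m → E) (u y z : E) {a b H' : ℝ}
    (h1 : ∑ j, (|inner ℝ (x j) u| ^ (p - 1)) ^ 2 * inner ℝ (x j) (y - z) ^ 2 ≤ a ^ 2)
    (h2 : ∀ j, |inner ℝ (x j) (y - z)| ≤ b)
    (hy : ∑ j, |inner ℝ (x j) (y - u)| ^ (p - 2 + p) ≤ H')
    (hz : ∑ j, |inner ℝ (x j) (z - u)| ^ (p - 2 + p) ≤ H') :
    ∑ j, (signedPow p (inner ℝ (x j) y) - signedPow p (inner ℝ (x j) z)) ^ 2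
      ≤ 3 * (p * 2 ^ (p - 1)) ^ 2 * (a ^ 2 + 2 * b ^ 2 * H') := by
  have hp1 : 0 ≤ p - 1 := by linarith
  have hsq : ∀ t : ℝ, 0 ≤ t → (t ^ (p - 1)) ^ 2 = t ^ (p - 2 + p) := by
    intro t ht
    rw [← Real.rpow_natCast, ← Real.rpow_mul ht]
    congr 1
    push_cast
    ring
  have hterm : ∀ j, (signedPow p (inner ℝ (x j) y) - signedPow p (inner ℝ (x j) z)) ^ 2
      ≤ 3 * (p * 2 ^ (p - 1)) ^ 2 *
        ((|inner ℝ (x j) u| ^ (p - 1)) ^ 2 * inner ℝ (x j) (y - z) ^ 2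
          + b ^ 2 * (|inner ℝ (x j) (y - u)| ^ (p - 2 + p)
          + |inner ℝ (x j) (z - u)| ^ (p - 2 + p))) := by
    intro j
    set U := |inner ℝ (x j) u|
    set v := |inner ℝ (x j) (y - u)|
    set w := |inner ℝ (x j) (z - u)|
    set d := |inner ℝ (x j) (y - z)|
    have hU : 0 ≤ U := abs_nonneg _
    have hv : 0 ≤ v := abs_nonneg _
    have hw : 0 ≤ w := abs_nonneg _
    have hd : 0 ≤ d := abs_nonneg _
    have hmax : max |inner ℝ (x j) y| |inner ℝ (x j) z| ≤ U + max v w := by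
      have e1 : inner ℝ (x j) y = inner ℝ (x j) u + inner ℝ (x j) (y - u) := by
        rw [← inner_add_right]; congr 1; abel
      have e2 : inner ℝ (x j) z = inner ℝ (x j) u + inner ℝ (x j) (z - u) := by
        rw [← inner_add_right]; congr 1; abel
      refine max_le ?_ ?_
      · rw [e1]
        exact (abs_add_le _ _).trans (by gcongr; exact le_max_left _ _)
      · rw [e2]
        exact (abs_add_le _ _).trans (by gcongr; exact le_max_right _ _)
    have hA : |signedPow p (inner ℝ (x j) y) - signedPow p (inner ℝ (x j) z)|
        ≤ p * 2 ^ (p - 1) * (d * (U ^ (p - 1) + v ^ (p - 1) + w ^ (p - 1))) := by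
      have hd' : |inner ℝ (x j) y - inner ℝ (x j) z| = d := by rw [← inner_sub_right]
      calc _ ≤ p * |inner ℝ (x j) y - inner ℝ (x j) z|
            * max |inner ℝ (x j) y| |inner ℝ (x j) z| ^ (p - 1) := abs_signedPow_sub_le hp _ _
        _ ≤ p * d * (U + max v w) ^ (p - 1) := by
            rw [hd']
            gcongr
        _ ≤ p * d * (2 ^ (p - 1) * (U ^ (p - 1) + v ^ (p - 1) + w ^ (p - 1))) := by
            gcongr
            exact add_add_rpow_le hU hv hw hp1
        _ = _ := by ring
    have hB := pow_le_pow_left₀ (abs_nonneg _) hA 2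
    rw [sq_abs] at hB
    refine hB.trans ?_
    have hd2 : inner ℝ (x j) (y - z) ^ 2 = d ^ 2 := (sq_abs _).symm
    rw [hd2, ← hsq v hv, ← hsq w hw, mul_pow, mul_comm (3 : ℝ), mul_assoc]
    gcongr
    have hdb : d ^ 2 ≤ b ^ 2 := pow_le_pow_left₀ hd (h2 j) 2
    set α := U ^ (p - 1)
    set β := v ^ (p - 1)
    set γ := w ^ (p - 1)
    have h3 : (α + β + γ) ^ 2 ≤ 3 * (α ^ 2 + β ^ 2 + γ ^ 2) := by
      nlinarith [sq_nonneg (α - β), sq_nonneg (β - γ), sq_nonneg (α - γ)]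
    calc (d * (α + β + γ)) ^ 2 = d ^ 2 * (α + β + γ) ^ 2 := by ring
      _ ≤ d ^ 2 * (3 * (α ^ 2 + β ^ 2 + γ ^ 2)) := by gcongr
      _ = 3 * (α ^ 2 * d ^ 2 + d ^ 2 * (β ^ 2 + γ ^ 2)) := by ring
      _ ≤ _ := by gcongr
  refine (Finset.sum_le_sum fun j _ => hterm j).trans ?_
  rw [← Finset.mul_sum, Finset.sum_add_distrib, ← Finset.mul_sum, Finset.sum_add_distrib]
  refine mul_le_mul_of_nonneg_left ?_ (by positivity)
  have := mul_le_mul_of_nonneg_left (add_le_add hy hz) (sq_nonneg b)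
  linarith

end Entropy

section EntropyGaussian

variable {E : Type*} [NormedAddCommGroup E] [InnerProductSpace ℝ E] [FiniteDimensional ℝ E]
  [MeasurableSpace E] [BorelSpace E] {m : ℕ}

/-- The entropy estimate: a subset of `K` of diameter `ρ` for the norm of `K` can be cut into
`2 ^ 4 ^ (n + 1)` pieces that are small in the metric of `powerMap`. The term linear in `ρ` carries
no logarithm; the logarithm comes with `ρ ^ p`. -/
theorem exists_cover_powerMap {K : Set E} {D R M p ρ : ℝ} (hm : 2 ≤ m) (hp : 2 ≤ p)
    (hK : IsSymmConvexBody K) (hD : K ⊆ Metric.closedBall 0 D) (hD0 : 0 < D) (hR0 : 0 < R)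
    (hM0 : 0 < M) {x : Fin m → E} (hx : ∀ j, ‖x j‖ ≤ R)
    (hM : ∀ y ∈ K, ∑ j, |inner ℝ (x j) y| ^ p ≤ M) (hρ : 0 ≤ ρ) {B : Set E} (hBK : B ⊆ K)
    (hB : ∀ y ∈ B, ∀ z ∈ B, gauge K (y - z) ≤ ρ) (n : ℕ) :
    ∃ c : E → Fin (2 ^ 4 ^ (n + 1)), ∀ y ∈ B, ∀ z ∈ B, c y = c z →
      dist (powerMap p x y) (powerMap p x z)
        ≤ 16 ^ p * ((D * R) ^ (p / 2) * √M) / 2 ^ n * (ρ + ρ ^ p * √(2 * Real.log m)) := by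
  have hnorm : ∀ y, ‖y‖ ≤ D * gauge K y := by
    intro y
    have := le_gauge_of_subset_closedBall (absorbent_nhds_zero hK.zero_mem_nhds) hD0.le hD (x := y)
    rwa [div_le_iff₀ hD0, mul_comm] at this
  rcases B.eq_empty_or_nonempty with rfl | ⟨u, hu⟩
  · exact ⟨fun _ => ⟨0, by positivity⟩, by simp⟩
  rcases hρ.eq_or_lt with rfl | hρ
  · refine ⟨fun _ => ⟨0, by positivity⟩, fun y hy z hz _ => ?_⟩
    have h1 := hnorm (y - z)
    have h2 := mul_le_mul_of_nonneg_left (hB y hy z hz) hD0.le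
    have h3 : y - z = 0 := norm_le_zero_iff.1 (by linarith)
    rw [sub_eq_zero.1 h3, dist_self]
    positivity
  have hDR : 0 < D * R := by positivity
  set H : ℝ := (D * R) ^ (p - 2) * M with hH
  have hH0 : 0 < H := by positivity
  have hsq : ∀ t : ℝ, 0 ≤ t → (t ^ (p - 1)) ^ 2 = t ^ (p - 2 + p) := by
    intro t ht
    rw [← Real.rpow_natCast, ← Real.rpow_mul ht]
    congr 1
    push_cast
    ring
  have hweights : ∀ y ∈ K, ∑ j, |inner ℝ (x j) y| ^ (p - 2 + p) ≤ H := fun y hy =>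
    sum_rpow_inner_le (by linarith) (by linarith) hD hR0.le hD0.le hx hM hy
  obtain ⟨c, hc⟩ := exists_cover_weighted_and_max hm x (fun j => |inner ℝ (x j) u| ^ (p - 1))
    hR0 hH0 (show 0 < ρ * D by positivity) hx
    (by simp_rw [hsq _ (abs_nonneg _)]; exact hweights u (hBK hu)) n
  refine ⟨fun y => c (y - u), fun y hy z hz hyz => ?_⟩
  have hball : ∀ y ∈ B, ‖y - u‖ ≤ ρ * D := fun y hy => by
    rw [mul_comm]
    exact (hnorm _).trans (by gcongr; exact hB y hy u hu)
  obtain ⟨h1, h2⟩ := hc (y - u) (z - u) (hball y hy) (hball z hz) hyz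
  rw [sub_sub_sub_cancel_right] at h1 h2
  have hloc : ∀ y ∈ B, ∑ j, |inner ℝ (x j) (y - u)| ^ (p - 2 + p) ≤ ρ ^ (p - 2 + p) * H := by
    intro y hy
    obtain ⟨k, hk, hyk⟩ := hK.mem_smul_of_gauge_le hρ (hB y hy u hu)
    rw [hyk]
    simp_rw [inner_smul_right, abs_mul, abs_of_pos hρ]
    simp_rw [Real.mul_rpow hρ.le (abs_nonneg _)]
    rw [← Finset.mul_sum]
    gcongr
    exact hweights k hk
  have h1' : ∑ j, (|inner ℝ (x j) u| ^ (p - 1)) ^ 2 * inner ℝ (x j) (y - z) ^ 2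
      ≤ (12 * (ρ * D) * R / 2 ^ n * √H) ^ 2 := by
    rw [mul_pow, Real.sq_sqrt hH0.le]
    exact h1
  have hsum := sum_signedPow_sub_sq_le hp x u y z h1' h2 (hloc y hy) (hloc z hz)
  set l := √(2 * Real.log m) with hl
  have hl0 : 0 ≤ l := Real.sqrt_nonneg _
  have hρp : ρ * ρ ^ (p - 1) = ρ ^ p := by
    rw [Real.rpow_sub_one hρ.ne']
    field_simp
  have hQ : D * R * √H = (D * R) ^ (p / 2) * √M := by
    rw [hH, Real.sqrt_mul (by positivity), Real.sqrt_eq_rpow ((D * R) ^ (p - 2)),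
      ← Real.rpow_mul hDR.le, ← mul_assoc]
    congr 1
    nth_rewrite 1 [← Real.rpow_one (D * R)]
    rw [← Real.rpow_add hDR]
    congr 1
    ring
  have hp2 : p ≤ 2 ^ p := by
    have h := one_add_mul_self_le_rpow_one_add (s := 1) (by norm_num) (show 1 ≤ p by linarith)
    norm_num at h
    linarith
  have hconst : 21 * (p * 2 ^ (p - 1)) ≤ 16 ^ p := by
    have e1 : (2 : ℝ) ^ (p - 1) = 2 ^ p / 2 := by rw [Real.rpow_sub_one (by norm_num)]
    have e2 : (16 : ℝ) ^ p = 2 ^ p * 2 ^ p * 4 ^ p := by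
      rw [← Real.mul_rpow (by norm_num) (by norm_num), ← Real.mul_rpow (by norm_num) (by norm_num)]
      norm_num
    have e3 : (16 : ℝ) ≤ 4 ^ p := by
      calc (16 : ℝ) = 4 ^ (2 : ℝ) := by norm_num
        _ ≤ _ := by gcongr; norm_num
    rw [e1, e2]
    have h2 : (0 : ℝ) < 2 ^ p := by positivity
    calc 21 * (p * (2 ^ p / 2)) ≤ 21 * (2 ^ p * (2 ^ p / 2)) := by gcongr
      _ ≤ 2 ^ p * 2 ^ p * 16 := by nlinarith [mul_pos h2 h2]
      _ ≤ _ := by gcongr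
  rw [dist_powerMap]
  refine Real.sqrt_le_iff.2 ⟨by positivity, hsum.trans ?_⟩
  rw [← hsq ρ hρ.le, ← hρp, ← hQ]
  set τ := ρ ^ (p - 1)
  have hτ : 0 ≤ τ := by positivity
  set Y := D * R * √H / 2 ^ n with hY
  have hY0 : 0 ≤ Y := by positivity
  have hHsq : √H ^ 2 = H := Real.sq_sqrt hH0.le
  calc 3 * (p * 2 ^ (p - 1)) ^ 2 * ((12 * (ρ * D) * R / 2 ^ n * √H) ^ 2
        + 2 * (8 * (ρ * D) * R * l / 2 ^ n) ^ 2 * (τ ^ 2 * H))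
      = (p * 2 ^ (p - 1)) ^ 2 * (Y * ρ) ^ 2 * (432 + 384 * (τ * l) ^ 2) := by
        rw [hY, ← hHsq]
        simp only [Real.sqrt_sq (Real.sqrt_nonneg H)]
        ring
    _ ≤ (p * 2 ^ (p - 1)) ^ 2 * (Y * ρ) ^ 2 * (441 * (1 + τ * l) ^ 2) := by
        gcongr
        nlinarith [mul_nonneg hτ hl0]
    _ = (21 * (p * 2 ^ (p - 1)) * (Y * (ρ * (1 + τ * l)))) ^ 2 := by ring
    _ ≤ (16 ^ p * (Y * (ρ * (1 + τ * l)))) ^ 2 := by gcongr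
    _ = _ := by rw [hY]; ring

end EntropyGaussian

/-! ### The Rademacher process of the `p`-th powers of functionals -/

section Rademacher

theorem rpow_one_div_le {q q' l t : ℝ} (hq : 2 ≤ q) (hqq : q.HolderConjugate q') (hl : 1 ≤ l)
    (ht : 0 ≤ t) : t ^ (1 / q) ≤ l ^ (1 / q') * (t + 1 / l) := by
  have hl0 : 0 < l := by linarith
  have hq' : 1 / q' = 1 - 1 / q := by
    have := hqq.inv_add_inv_eq_one
    rw [one_div, one_div]
    linarith
  have hinv : 1 / q ≤ 1 := by rw [div_le_one (by linarith)]; linarith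
  have hlpow : 1 ≤ l ^ (1 / q') := Real.one_le_rpow hl (by rw [hq']; linarith)
  rcases le_total t (1 / l) with h | h
  · calc t ^ (1 / q) ≤ (1 / l) ^ (1 / q) := Real.rpow_le_rpow ht h (by positivity)
      _ = l ^ (1 / q') * (1 / l) := by
          rw [hq', Real.rpow_sub hl0, Real.rpow_one, one_div l, Real.inv_rpow hl0.le]
          field_simp
      _ ≤ _ := by gcongr; linarith
  · have ht0 : 0 < t := lt_of_lt_of_le (by positivity) h
    have h1 : t ^ (1 / q) = t * (1 / t) ^ (1 / q') := by
      rw [hq', one_div t, Real.inv_rpow ht0.le, Real.rpow_sub ht0, Real.rpow_one]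
      field_simp
    have h2 : 1 / t ≤ l := by
      rw [div_le_iff₀ ht0]
      rw [div_le_iff₀ hl0] at h
      linarith
    have h3 : (1 / t) ^ (1 / q') ≤ l ^ (1 / q') :=
      Real.rpow_le_rpow (by positivity) h2 (by rw [hq']; linarith)
    rw [h1, mul_comm]
    gcongr
    have : 0 ≤ 1 / l := by positivity
    linarith

/-- The number of scales is of order `log m`. -/
theorem clog_four_add_one_le {m : ℕ} (hm : 2 ≤ m) :
    ((Nat.clog 4 m : ℕ) : ℝ) + 1 ≤ 3 * (2 * Real.log m) := by
  have hm2 : (2 : ℝ) ≤ m := by exact_mod_cast hm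
  have hlog2 : Real.log 2 ≤ Real.log m := Real.log_le_log (by norm_num) hm2
  have hl2 := Real.log_two_gt_d9
  have h4 : Real.log 4 = 2 * Real.log 2 := by
    rw [show (4 : ℝ) = 2 ^ 2 by norm_num, Real.log_pow]
    norm_num
  have hpos : 0 < Nat.clog 4 m := Nat.clog_pos (by norm_num) hm
  have h1 : 4 ^ (Nat.clog 4 m - 1) < m := Nat.pow_pred_clog_lt_self (by norm_num) hm
  have h2 : ((Nat.clog 4 m - 1 : ℕ) : ℝ) * Real.log 4 ≤ Real.log m := by
    rw [← Real.log_pow]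
    apply Real.log_le_log (by positivity)
    exact_mod_cast h1.le
  rw [Nat.cast_sub hpos, Nat.cast_one, h4] at h2
  nlinarith

variable {E : Type*} [NormedAddCommGroup E] [InnerProductSpace ℝ E] [FiniteDimensional ℝ E]
  [MeasurableSpace E] [BorelSpace E] {m : ℕ}

/-- The chaining functional of `K` for the metric of `powerMap`. The contraction hypothesis is
checked by projecting a subset of `K` to the minimizers of the penalized functional at scale `n`,
where power type convexity turns the diameter into a bound for the norm of `K`, and covering these
minimizers by the entropy estimate. -/
theorem chainBound_powerMap {K : Set E} {D R M p q q' lam : ℝ} (hm : 2 ≤ m) (hq : 2 ≤ q)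
    (hqq : q.HolderConjugate q') (hqp : q ≤ p) (hlam : 1 ≤ lam)
    (hK : IsSymmConvexBody K) (hconv : HasPowerTypeConvexity K q lam)
    (hD : K ⊆ Metric.closedBall 0 D) (hD0 : 0 < D) (hR0 : 0 < R)
    (hM0 : 0 < M) {x : Fin m → E} (hx : ∀ j, ‖x j‖ ≤ R)
    (hM : ∀ y ∈ K, ∑ j, |inner ℝ (x j) y| ^ p ≤ M) :
    ChainBound (fun y : K => powerMap p x y) (Nat.clog 4 m)
      (1209 * (32 ^ p * ((D * R) ^ (p / 2) * √M) * lam ^ p * (2 * Real.log m) ^ (1 / q'))) := by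
  have hp : 2 ≤ p := hq.trans hqp
  have hp1 : 1 < p := by linarith
  set Q := (D * R) ^ (p / 2) * √M with hQ
  have hQ0 : 0 < Q := by positivity
  set l := 2 * Real.log m with hl
  have hl1 : 1 ≤ l := by
    have hm2 : (2 : ℝ) ≤ m := by exact_mod_cast hm
    have hlog2 : Real.log 2 ≤ Real.log m := Real.log_le_log (by norm_num) hm2
    have := Real.log_two_gt_d9
    linarith
  have hl0 : 0 < l := by linarith
  have hlam0 : 0 < lam := by linarith
  set N := Nat.clog 4 m with hN
  set G := 32 ^ p * Q * lam ^ p * l ^ (1 / q') with hG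
  have hG0 : 0 < G := by positivity
  have hq'h : 1 / 2 ≤ 1 / q' := by
    have h1 := hqq.inv_add_inv_eq_one
    have h2 : q⁻¹ ≤ 1 / 2 := by
      rw [one_div]
      exact inv_anti₀ (by norm_num) hq
    rw [one_div q']
    linarith
  have hlpow1 : 1 ≤ l ^ (1 / q') := Real.one_le_rpow hl1 (by linarith)
  have hlsqrt : √l ≤ l ^ (1 / q') := by
    rw [Real.sqrt_eq_rpow]
    exact Real.rpow_le_rpow_of_exponent_le hl1 hq'h
  have hlamp : lam ≤ lam ^ p := by
    nth_rewrite 1 [← Real.rpow_one lam]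
    exact Real.rpow_le_rpow_of_exponent_le hlam hp1.le
  have h2p : (2 : ℝ) ≤ 2 ^ p := by
    nth_rewrite 1 [← Real.rpow_one 2]
    exact Real.rpow_le_rpow_of_exponent_le (by norm_num) hp1.le
  set τ := 1 / (8 * G) with hτ
  have hτ0 : 0 < τ := by positivity
  have hgc : Continuous fun y => gauge K y ^ q :=
    (continuous_gauge hK.convex hK.zero_mem_nhds).rpow_const fun _ => Or.inr (by linarith)
  have hF := continuous_powerMap hp1 x
  choose π hπ using fun n : ℕ =>
    exists_penalized_minimizer hK.isCompact ⟨0, hK.zero_mem⟩ hgc hF (τ * 2 ^ n)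
  let s : ℕ → K → ℝ := fun n y => 4 * dist (powerMap p x y) (powerMap p x (π n y)) + G / (2 ^ n * l)
  have hs0 : ∀ n y, 0 ≤ s n y := fun n y => by positivity
  have hsS : ∀ y, ∑ n ∈ Finset.range (N + 1), 2 ^ n * s n y ≤ 67 * G := by
    intro y
    have h1 := sum_dist_penalized_le hτ0 (fun y => Real.rpow_nonneg (gauge_nonneg y) q) hπ y.2
      (Real.rpow_le_one (gauge_nonneg _) (gauge_le_one_of_mem y.2) (by linarith)) N
    have h2 : ∀ n ∈ Finset.range (N + 1), 2 ^ n * s n y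
        = 4 * (2 ^ n * dist (powerMap p x y) (powerMap p x (π n y))) + G / l := by
      intro n _
      simp only [s]
      field_simp
    rw [Finset.sum_congr rfl h2, Finset.sum_add_distrib, ← Finset.mul_sum, Finset.sum_const,
      Finset.card_range, nsmul_eq_mul]
    have h3 : ((N + 1 : ℕ) : ℝ) * (G / l) ≤ 3 * G := by
      have := clog_four_add_one_le hm
      push_cast
      calc _ ≤ 3 * l * (G / l) := by gcongr
        _ = _ := by field_simp
    have h4 : 2 / τ = 16 * G := by
      rw [hτ]
      field_simp
      norm_num
    rw [h4] at h1
    linarith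
  have hdiam : ∀ y z : K, dist (powerMap p x y) (powerMap p x z) ≤ G := by
    intro y z
    refine (dist_powerMap_le_diam hp1 hD hR0.le hD0.le hx hM y.2 z.2).trans ?_
    rw [← hQ, hG]
    have h1 : (2 : ℝ) ≤ 32 ^ p :=
      h2p.trans (Real.rpow_le_rpow (by norm_num) (by norm_num) (by linarith))
    have h2 : 1 ≤ lam ^ p := hlam.trans hlamp
    calc 2 * Q = 2 * Q * 1 * 1 := by ring
      _ ≤ _ := by gcongr
  refine (ChainBound.of_contraction (F := fun y : K => powerMap p x y) (S := 67 * G)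
    (by positivity) hG0.le hdiam hs0 hsS ?_).mono (le_of_eq (by ring))
  intro n _ A Δ σ hΔ hσ
  rcases A.eq_empty_or_nonempty with rfl | ⟨a₀, ha₀⟩
  · exact ⟨fun _ => ⟨0, by positivity⟩, by simp⟩
  -- on `A` the penalized projection at scale `n` moves points by at most `σ₀`
  set σ₀ := (σ - G / (2 ^ n * l)) / 4 with hσ₀
  have hmove : ∀ y ∈ A, dist (powerMap p x y) (powerMap p x (π n y)) ≤ σ₀ := by
    intro y hy
    have := hσ y hy
    simp only [s] at this
    rw [hσ₀]
    linarith
  have hσ₀0 : 0 ≤ σ₀ := dist_nonneg.trans (hmove a₀ ha₀)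
  have hΔ0 : 0 ≤ Δ := dist_nonneg.trans (hΔ a₀ ha₀ a₀ ha₀)
  set Δ' := Δ + 2 * σ₀ with hΔ'
  have hΔ'0 : 0 ≤ Δ' := by positivity
  have hdist : ∀ y ∈ A, ∀ z ∈ A, dist (powerMap p x (π n y)) (powerMap p x (π n z)) ≤ Δ' := by
    intro y hy z hz
    have h1 := dist_triangle4 (powerMap p x (π n y)) (powerMap p x y) (powerMap p x z)
      (powerMap p x (π n z))
    rw [dist_comm (powerMap p x (π n y)) (powerMap p x y)] at h1
    have := hmove y hy
    have := hmove z hz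
    have := hΔ y hy z hz
    rw [hΔ']
    linarith
  set t := min 1 (τ * 2 ^ n * Δ') with ht
  have ht0 : 0 ≤ t := by positivity
  have ht1 : t ≤ 1 := min_le_left _ _
  set ρ := 2 * lam * t ^ (1 / q) with hρ
  have hρ0 : 0 ≤ ρ := by positivity
  have hB : ∀ u ∈ (fun y : K => π n y) '' A, ∀ v ∈ (fun y : K => π n y) '' A,
      gauge K (u - v) ≤ ρ := by
    rintro _ ⟨y, hy, rfl⟩ _ ⟨z, hz, rfl⟩
    exact hconv.gauge_sub_le hK (by linarith) hlam (by positivity)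
      (dist_powerMap_midpoint hp1 x) (hπ n y).1 (hπ n z).1 (hπ n y).2 (hπ n z).2
      (hdist y hy z hz)
  obtain ⟨c, hc⟩ := exists_cover_powerMap hm hp hK hD hD0 hR0 hM0 hx hM hρ0
    (by rintro _ ⟨y, -, rfl⟩; exact (hπ n y).1) hB n
  refine ⟨fun y => c (π n y), fun y hy z hz hyz => ?_⟩
  have h1 := hc _ ⟨y, hy, rfl⟩ _ ⟨z, hz, rfl⟩ hyz
  rw [← hQ, ← hl] at h1
  have hρ1 : ρ ≤ (2 * lam) ^ p * l ^ (1 / q') * (t + 1 / l) := by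
    have h2 := rpow_one_div_le hq hqq hl1 ht0
    calc ρ ≤ 2 * lam * (l ^ (1 / q') * (t + 1 / l)) := by rw [hρ]; gcongr
      _ ≤ 2 ^ p * lam ^ p * (l ^ (1 / q') * (t + 1 / l)) := by gcongr
      _ = _ := by rw [Real.mul_rpow (by norm_num) hlam0.le]; ring
  have hρ2 : ρ ^ p * √l ≤ (2 * lam) ^ p * l ^ (1 / q') * t := by
    have h2 : (t ^ (1 / q)) ^ p ≤ t := by
      rw [← Real.rpow_mul ht0]
      have : 1 ≤ 1 / q * p := by
        rw [div_mul_eq_mul_div, one_mul, le_div_iff₀ (by linarith)]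
        linarith
      rcases ht0.eq_or_lt with h0 | h0
      · rw [← h0, Real.zero_rpow (by linarith)]
      · nth_rewrite 2 [← Real.rpow_one t]
        exact Real.rpow_le_rpow_of_exponent_ge h0 ht1 this
    calc ρ ^ p * √l = (2 * lam) ^ p * (t ^ (1 / q)) ^ p * √l := by
          rw [hρ, Real.mul_rpow (by positivity) (by positivity)]
      _ ≤ (2 * lam) ^ p * t * l ^ (1 / q') := by gcongr
      _ = _ := by ring
  have h3 : dist (powerMap p x (π n y)) (powerMap p x (π n z))
      ≤ 1 / 4 * Δ' + G / (2 ^ n * l) := by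
    refine h1.trans ?_
    have ht2 : t ≤ τ * 2 ^ n * Δ' := min_le_right _ _
    have h32 : (16 : ℝ) ^ p * (2 * lam) ^ p = 32 ^ p * lam ^ p := by
      rw [Real.mul_rpow (by norm_num) hlam0.le, ← mul_assoc,
        ← Real.mul_rpow (by norm_num) (by norm_num)]
      norm_num
    calc _ ≤ 16 ^ p * Q / 2 ^ n * ((2 * lam) ^ p * l ^ (1 / q') * (t + 1 / l)
          + (2 * lam) ^ p * l ^ (1 / q') * t) := by gcongr
      _ = (16 ^ p * (2 * lam) ^ p) * Q * l ^ (1 / q') / 2 ^ n * (2 * t + 1 / l) := by ring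
      _ = G / 2 ^ n * (2 * t + 1 / l) := by rw [h32, hG]; ring
      _ ≤ G / 2 ^ n * (2 * (τ * 2 ^ n * Δ') + 1 / l) := by gcongr
      _ = _ := by
        rw [hτ]
        field_simp
        ring
  have h4 := dist_triangle4 (powerMap p x y) (powerMap p x (π n y)) (powerMap p x (π n z))
    (powerMap p x z)
  rw [dist_comm (powerMap p x (π n z))] at h4
  have h5 := hmove y hy
  have h6 := hmove z hz
  have h7 : σ = 4 * σ₀ + G / (2 ^ n * l) := by rw [hσ₀]; ring
  refine h4.trans ?_
  rw [h7]
  rw [hΔ'] at h3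
  linarith

/-- The Rademacher average of `sup_{y ∈ K} |∑ ε j * |⟨x j, y⟩| ^ p|`, for fixed vectors `x j`;
`W ε` bounds the supremum for the signs `ε`. -/
theorem exists_rademacher_sup_bound {K : Set E} {D R M p q q' lam : ℝ} (hm : 2 ≤ m) (hq : 2 ≤ q)
    (hqq : q.HolderConjugate q') (hqp : q ≤ p) (hlam0 : 0 < lam)
    (hK : IsSymmConvexBody K) (hconv : HasPowerTypeConvexity K q lam)
    (hD : K ⊆ Metric.closedBall 0 D) {x : Fin m → E} (hx : ∀ j, ‖x j‖ ≤ R)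
    (hM : ∀ y ∈ K, ∑ j, |inner ℝ (x j) y| ^ p ≤ M) :
    ∃ W : (Fin m → Bool) → ℝ,
      ∑ ε, W ε ≤ 2 ^ m * (16384 ^ p * lam ^ p * Real.log m ^ (1 / q') * ((D * R) ^ (p / 2) * √M)) ∧
      ∀ ε, ∀ y ∈ K, |∑ j, boolSign (ε j) * |inner ℝ (x j) y| ^ p| ≤ W ε := by
  have hp : 2 ≤ p := hq.trans hqp
  have hlogm : 0 ≤ Real.log m := Real.log_natCast_nonneg m
  have hD0' : 0 ≤ D := by simpa using hD hK.zero_mem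
  have hR0' : 0 ≤ R := (norm_nonneg _).trans (hx ⟨0, by omega⟩)
  have hM0' : 0 ≤ M := by
    refine le_trans (Finset.sum_nonneg fun j _ => ?_) (hM 0 hK.zero_mem)
    positivity
  -- if one of `D`, `R`, `M` vanishes, then so does the process
  by_cases hdeg : D = 0 ∨ R = 0 ∨ M = 0
  · refine ⟨fun _ => 0, by simp; positivity, fun ε y hy => ?_⟩
    have hzero : ∀ j, |inner ℝ (x j) y| ^ p = 0 := by
      intro j
      rcases hdeg with h | h | h
      · have := abs_inner_le_of_subset_closedBall hD (hx j) hy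
        rw [h, zero_mul] at this
        rw [le_antisymm this (abs_nonneg _), Real.zero_rpow (by linarith)]
      · have := abs_inner_le_of_subset_closedBall hD (hx j) hy
        rw [h, mul_zero] at this
        rw [le_antisymm this (abs_nonneg _), Real.zero_rpow (by linarith)]
      · have h1 := hM y hy
        rw [h] at h1
        have h2 := Finset.single_le_sum (f := fun j => |inner ℝ (x j) y| ^ p)
          (fun i _ => by positivity) (Finset.mem_univ j)
        exact le_antisymm (h2.trans h1) (by positivity)
    simp [hzero]
  push Not at hdeg
  have hD0 : 0 < D := lt_of_le_of_ne hD0' hdeg.1.symm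
  have hR0 : 0 < R := lt_of_le_of_ne hR0' hdeg.2.1.symm
  have hM0 : 0 < M := lt_of_le_of_ne hM0' hdeg.2.2.symm
  rcases subsingleton_or_nontrivial E with hE | hE
  · refine ⟨fun _ => 0, by simp; positivity, fun ε y hy => ?_⟩
    have hzero : ∀ j, |inner ℝ (x j) y| ^ p = 0 := fun j => by
      rw [Subsingleton.elim y 0, inner_zero_right, abs_zero, Real.zero_rpow (by linarith)]
    simp [hzero]
  have hlam : 1 ≤ lam := hconv.one_le hK (by linarith) hlam0
  have hchain := chainBound_powerMap hm hq hqq hqp hlam hK hconv hD hD0 hR0 hM0 hx hM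
  obtain ⟨W, hW1, hW2⟩ := hchain.rademacher (by positivity) (Nat.le_pow_clog (by norm_num) m)
    (fun (y : K) j => |inner ℝ (x j) (y : E)| ^ p) (fun y z => sqrt_sum_le_dist_powerMap (by linarith) x y z)
  refine ⟨W, hW1.trans ?_, fun ε y hy => ?_⟩
  · have hq'0 : 0 ≤ 1 / q' := by have := hqq.symm.pos; positivity
    have hq'1 : 1 / q' ≤ 1 := by
      have := hqq.symm.lt
      rw [div_le_one (by linarith)]
      exact this.le
    have h2 : (2 * Real.log m) ^ (1 / q') ≤ 2 * Real.log m ^ (1 / q') := by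
      rw [Real.mul_rpow (by norm_num) hlogm]
      gcongr
      nth_rewrite 2 [← Real.rpow_one 2]
      exact Real.rpow_le_rpow_of_exponent_le (by norm_num) hq'1
    have h512 : (246636 : ℝ) ≤ 512 ^ p := by
      calc (246636 : ℝ) ≤ 512 ^ (2 : ℝ) := by norm_num
        _ ≤ _ := Real.rpow_le_rpow_of_exponent_le (by norm_num) hp
    have hconst : (16384 : ℝ) ^ p = 512 ^ p * 32 ^ p := by
      rw [← Real.mul_rpow (by norm_num) (by norm_num)]
      norm_num
    rw [hconst]
    calc _ ≤ 2 ^ m * (102 * (1209 * (32 ^ p * ((D * R) ^ (p / 2) * √M) * lam ^ p *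
          (2 * Real.log m ^ (1 / q'))))) := by gcongr
      _ = 2 ^ m * (246636 * 32 ^ p * lam ^ p * Real.log m ^ (1 / q')
          * ((D * R) ^ (p / 2) * √M)) := by ring
      _ ≤ _ := by gcongr
  · have h := hW2 ε ⟨y, hy⟩ ⟨0, hK.zero_mem⟩
    simpa [Real.zero_rpow (show p ≠ 0 by linarith)] using h

end Rademacher

/-! ### Suprema over the body as random variables -/

section Suprema

theorem continuous_iSup_of_compactSpace {α κ : Type*} [TopologicalSpace α] [TopologicalSpace κ]
    [CompactSpace κ] {f : α → κ → ℝ} (hf : Continuous (Function.uncurry f)) :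
    Continuous fun a => ⨆ k, f a k := by
  have := isCompact_univ.continuous_sSup (K := (Set.univ : Set κ)) hf
  simp only [Set.image_univ] at this
  exact this

theorem le_iSup_of_compactSpace {α κ : Type*} [TopologicalSpace α] [TopologicalSpace κ]
    [CompactSpace κ] {f : α → κ → ℝ} (hf : Continuous (Function.uncurry f)) (a : α) (k : κ) :
    f a k ≤ ⨆ k, f a k :=
  le_ciSup (isCompact_range (hf.comp (Continuous.prodMk_right a))).bddAbove k

variable {E : Type*} [NormedAddCommGroup E] [InnerProductSpace ℝ E] {m : ℕ}

/-- `sup_{y ∈ K} ∑ j, |⟨a j, y⟩| ^ p`. -/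
noncomputable def powerSup (K : Set E) (p : ℝ) (a : Fin m → E) : ℝ :=
  ⨆ y : K, ∑ j, |inner ℝ (a j) (y : E)| ^ p

/-- `sup_{y ∈ K} |∑ j, ε j * |⟨a j, y⟩| ^ p|` for the signs encoded by `ε`. -/
noncomputable def signedPowerSup (K : Set E) (p : ℝ) (ε : Fin m → Bool) (a : Fin m → E) : ℝ :=
  ⨆ y : K, |∑ j, boolSign (ε j) * |inner ℝ (a j) (y : E)| ^ p|

/-- `sup_{y ∈ K} |∑ j, (|⟨a j, y⟩| ^ p - |⟨b j, y⟩| ^ p)|` for a pair `(a, b)` of samples. -/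
noncomputable def pairedPowerSup (K : Set E) (p : ℝ) (z : (Fin m → E) × (Fin m → E)) : ℝ :=
  ⨆ y : K, |∑ j, (|inner ℝ (z.1 j) (y : E)| ^ p - |inner ℝ (z.2 j) (y : E)| ^ p)|

/-- The maximal deviation as a function of the sample `a`, for a law `μ`. -/
noncomputable def sampleDeviation [MeasurableSpace E] (μ : Measure E) (K : Set E) (p : ℝ)
    (a : Fin m → E) : ℝ :=
  ⨆ y : K, |(1 / (m : ℝ)) * ∑ j, |inner ℝ (a j) (y : E)| ^ p - ∫ v, |inner ℝ v (y : E)| ^ p ∂μ|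

variable {K : Set E} {p : ℝ}

theorem continuous_abs_inner_rpow (hp : 0 ≤ p) :
    Continuous fun z : E × E => |inner ℝ z.1 z.2| ^ p :=
  (continuous_abs.comp continuous_inner).rpow_const fun _ => Or.inr hp

theorem continuous_eval_abs_inner_rpow (hp : 0 ≤ p) (j : Fin m) :
    Continuous fun z : (Fin m → E) × K => |inner ℝ (z.1 j) (z.2 : E)| ^ p :=
  (continuous_abs_inner_rpow hp).comp (by fun_prop : Continuous fun z : (Fin m → E) × K =>
    (z.1 j, (z.2 : E)))

theorem abs_inner_rpow_le {D : ℝ} (hp : 0 ≤ p) (hD : K ⊆ Metric.closedBall 0 D) (v : E) {y : E}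
    (hy : y ∈ K) : |inner ℝ v y| ^ p ≤ D ^ p * ‖v‖ ^ p := by
  have hD0 : 0 ≤ D := (norm_nonneg y).trans (by simpa using hD hy)
  rw [← Real.mul_rpow hD0 (norm_nonneg v)]
  exact Real.rpow_le_rpow (abs_nonneg _) (abs_inner_le_of_subset_closedBall hD le_rfl hy) hp

theorem continuous_signedPowerSum (hp : 0 ≤ p) (ε : Fin m → Bool) :
    Continuous fun z : (Fin m → E) × K =>
      |∑ j, boolSign (ε j) * |inner ℝ (z.1 j) (z.2 : E)| ^ p| :=
  continuous_abs.comp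
    (continuous_finsetSum _ fun j _ => (continuous_eval_abs_inner_rpow hp j).const_mul _)

theorem continuous_pairedPowerSum (hp : 0 ≤ p) :
    Continuous fun z : ((Fin m → E) × (Fin m → E)) × K =>
      |∑ j, (|inner ℝ (z.1.1 j) (z.2 : E)| ^ p - |inner ℝ (z.1.2 j) (z.2 : E)| ^ p)| := by
  refine continuous_abs.comp (continuous_finsetSum _ fun j _ => ?_)
  have h := continuous_eval_abs_inner_rpow (K := K) hp j
  exact (h.comp (by fun_prop : Continuous fun z : ((Fin m → E) × (Fin m → E)) × K =>
    (z.1.1, z.2))).sub (h.comp (by fun_prop :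
      Continuous fun z : ((Fin m → E) × (Fin m → E)) × K => (z.1.2, z.2)))

theorem continuous_powerSup (hp : 0 ≤ p) [CompactSpace K] :
    Continuous (powerSup K p : (Fin m → E) → ℝ) :=
  continuous_iSup_of_compactSpace
    (continuous_finsetSum _ fun j _ => continuous_eval_abs_inner_rpow hp j)

theorem continuous_signedPowerSup (hp : 0 ≤ p) [CompactSpace K] (ε : Fin m → Bool) :
    Continuous (signedPowerSup K p ε) :=
  continuous_iSup_of_compactSpace (continuous_signedPowerSum hp ε)

theorem continuous_pairedPowerSup (hp : 0 ≤ p) [CompactSpace K] :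
    Continuous (pairedPowerSup K p : (Fin m → E) × (Fin m → E) → ℝ) :=
  continuous_iSup_of_compactSpace (continuous_pairedPowerSum hp)

theorem le_powerSup (hp : 0 ≤ p) [CompactSpace K] (a : Fin m → E) (y : K) :
    ∑ j, |inner ℝ (a j) (y : E)| ^ p ≤ powerSup K p a :=
  le_iSup_of_compactSpace (f := fun (a : Fin m → E) (y : K) => ∑ j, |inner ℝ (a j) (y : E)| ^ p)
    (continuous_finsetSum _ fun j _ => continuous_eval_abs_inner_rpow hp j) a y

theorem le_signedPowerSup (hp : 0 ≤ p) [CompactSpace K] (ε : Fin m → Bool) (a : Fin m → E)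
    (y : K) :
    |∑ j, boolSign (ε j) * |inner ℝ (a j) (y : E)| ^ p| ≤ signedPowerSup K p ε a :=
  le_iSup_of_compactSpace (f := fun (a : Fin m → E) (y : K) =>
    |∑ j, boolSign (ε j) * |inner ℝ (a j) (y : E)| ^ p|) (continuous_signedPowerSum hp ε) a y

theorem le_pairedPowerSup (hp : 0 ≤ p) [CompactSpace K] (z : (Fin m → E) × (Fin m → E)) (y : K) :
    |∑ j, (|inner ℝ (z.1 j) (y : E)| ^ p - |inner ℝ (z.2 j) (y : E)| ^ p)|
      ≤ pairedPowerSup K p z :=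
  le_iSup_of_compactSpace (f := fun (z : (Fin m → E) × (Fin m → E)) (y : K) =>
    |∑ j, (|inner ℝ (z.1 j) (y : E)| ^ p - |inner ℝ (z.2 j) (y : E)| ^ p)|)
    (continuous_pairedPowerSum hp) z y

theorem powerSup_nonneg (a : Fin m → E) : 0 ≤ powerSup K p a :=
  Real.iSup_nonneg fun _ => Finset.sum_nonneg fun _ _ => by positivity

theorem signedPowerSup_nonneg (ε : Fin m → Bool) (a : Fin m → E) : 0 ≤ signedPowerSup K p ε a :=
  Real.iSup_nonneg fun _ => abs_nonneg _

theorem pairedPowerSup_nonneg (z : (Fin m → E) × (Fin m → E)) : 0 ≤ pairedPowerSup K p z :=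
  Real.iSup_nonneg fun _ => abs_nonneg _

variable {D : ℝ}

theorem powerSup_le [Nonempty K] (hp : 0 ≤ p) (hD : K ⊆ Metric.closedBall 0 D) (a : Fin m → E) :
    powerSup K p a ≤ D ^ p * ∑ j, ‖a j‖ ^ p := by
  refine ciSup_le fun y => ?_
  rw [Finset.mul_sum]
  exact Finset.sum_le_sum fun j _ => abs_inner_rpow_le hp hD (a j) y.2

theorem signedPowerSup_le [Nonempty K] (hp : 0 ≤ p) (hD : K ⊆ Metric.closedBall 0 D)
    (ε : Fin m → Bool) (a : Fin m → E) :
    signedPowerSup K p ε a ≤ D ^ p * ∑ j, ‖a j‖ ^ p := by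
  refine ciSup_le fun y => ?_
  rw [Finset.mul_sum]
  refine (Finset.abs_sum_le_sum_abs _ _).trans (Finset.sum_le_sum fun j _ => ?_)
  rw [abs_mul, abs_boolSign, one_mul, abs_of_nonneg (by positivity)]
  exact abs_inner_rpow_le hp hD (a j) y.2

theorem pairedPowerSup_le [Nonempty K] (hp : 0 ≤ p) (hD : K ⊆ Metric.closedBall 0 D)
    (z : (Fin m → E) × (Fin m → E)) :
    pairedPowerSup K p z ≤ D ^ p * ∑ j, ‖z.1 j‖ ^ p + D ^ p * ∑ j, ‖z.2 j‖ ^ p := by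
  refine ciSup_le fun y => ?_
  rw [Finset.mul_sum, Finset.mul_sum, ← Finset.sum_add_distrib]
  refine (Finset.abs_sum_le_sum_abs _ _).trans (Finset.sum_le_sum fun j _ => ?_)
  refine (abs_sub _ _).trans ?_
  rw [abs_of_nonneg (a := |inner ℝ (z.1 j) (y : E)| ^ p) (by positivity),
    abs_of_nonneg (a := |inner ℝ (z.2 j) (y : E)| ^ p) (by positivity)]
  exact add_le_add (abs_inner_rpow_le hp hD _ y.2) (abs_inner_rpow_le hp hD _ y.2)

end Suprema

/-! ### Moments of the law -/

section Moments

theorem integrable_sum_norm_rpow {E : Type*} [NormedAddCommGroup E] [MeasurableSpace E]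
    {μ : Measure E} [IsProbabilityMeasure μ] {p : ℝ} {m : ℕ}
    (hμ : Integrable (fun v => ‖v‖ ^ p) μ) :
    Integrable (fun a : Fin m → E => ∑ j, ‖a j‖ ^ p) (Measure.pi fun _ => μ) :=
  integrable_finsetSum _ fun j _ =>
    (measurePreserving_eval (fun _ : Fin m => μ) j).integrable_comp_of_integrable hμ

theorem integrable_iSup_norm_rpow {E : Type*} [NormedAddCommGroup E] [MeasurableSpace E]
    [OpensMeasurableSpace E] {μ : Measure E} [IsProbabilityMeasure μ] {p : ℝ} {m : ℕ} (hm : 0 < m)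
    (hμ : Integrable (fun v => ‖v‖ ^ p) μ) :
    Integrable (fun a : Fin m → E => ⨆ j, ‖a j‖ ^ p) (Measure.pi fun _ => μ) := by
  have : Nonempty (Fin m) := ⟨⟨0, hm⟩⟩
  refine (integrable_sum_norm_rpow hμ).mono' ?_ (Filter.Eventually.of_forall fun a => ?_)
  · refine Measurable.aestronglyMeasurable (Measurable.iSup fun j => ?_)
    exact (measurable_pi_apply j).norm.pow_const p
  · rw [Real.norm_eq_abs, abs_of_nonneg (Real.iSup_nonneg fun j => by positivity)]
    exact ciSup_le fun j => Finset.single_le_sum (f := fun j => ‖a j‖ ^ p)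
      (fun i _ => by positivity) (Finset.mem_univ j)

variable {E : Type*} [NormedAddCommGroup E] [InnerProductSpace ℝ E]
  [MeasurableSpace E] [BorelSpace E] {K : Set E} {p D : ℝ} {μ : Measure E}

/-- Finiteness of the directional `p`-moments on a neighbourhood of `0` gives a finite `p`-moment
of the norm, by expanding in an orthonormal basis. -/
theorem integrable_norm_rpow_of_inner [FiniteDimensional ℝ E] (hp : 1 ≤ p) (hK : K ∈ nhds (0 : E))
    (h : ∀ y ∈ K, Integrable (fun v => |inner ℝ v y| ^ p) μ) :
    Integrable (fun v => ‖v‖ ^ p) μ := by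
  obtain ⟨r, hr, hball⟩ := Metric.nhds_basis_closedBall.mem_iff.1 hK
  let b := stdOrthonormalBasis ℝ E
  have hb : ∀ i, Integrable (fun v => |inner ℝ v (b i)| ^ p) μ := by
    intro i
    have hmem : r • b i ∈ K := hball (by simp [norm_smul, abs_of_pos hr])
    have h1 := (h _ hmem).const_mul ((r ^ p)⁻¹)
    refine h1.congr (Filter.Eventually.of_forall fun v => ?_)
    simp only
    rw [inner_smul_right, abs_mul, abs_of_pos hr, Real.mul_rpow hr.le (abs_nonneg _), ← mul_assoc,
      inv_mul_cancel₀ (by positivity), one_mul]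
  have hsum : Integrable (fun v => (Fintype.card (Fin (Module.finrank ℝ E)) : ℝ) ^ (p - 1) *
      ∑ i, |inner ℝ v (b i)| ^ p) μ :=
    (integrable_finsetSum _ fun i _ => hb i).const_mul _
  refine hsum.mono' ?_ (Filter.Eventually.of_forall fun v => ?_)
  · exact (continuous_norm.rpow_const fun _ => Or.inr (by linarith)).aestronglyMeasurable
  · rw [Real.norm_eq_abs, abs_of_nonneg (by positivity)]
    have h1 : ‖v‖ ≤ ∑ i, |inner ℝ v (b i)| := by
      conv_lhs => rw [← b.sum_repr' v]
      refine (norm_sum_le _ _).trans (Finset.sum_le_sum fun i _ => ?_)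
      rw [norm_smul, b.norm_eq_one, mul_one, Real.norm_eq_abs, real_inner_comm]
    calc ‖v‖ ^ p ≤ (∑ i, |inner ℝ v (b i)|) ^ p :=
          Real.rpow_le_rpow (norm_nonneg _) h1 (by linarith)
      _ ≤ _ := by
          have := Real.rpow_sum_le_const_mul_sum_rpow Finset.univ
            (fun i => inner ℝ v (b i)) hp
          simpa using this

theorem continuous_moment (hp : 0 ≤ p) (hD : K ⊆ Metric.closedBall 0 D)
    (hμ : Integrable (fun v => ‖v‖ ^ p) μ) :
    Continuous fun y : K => ∫ v, |inner ℝ v (y : E)| ^ p ∂μ := by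
  refine continuous_of_dominated (bound := fun v => D ^ p * ‖v‖ ^ p) (fun y => ?_) (fun y => ?_)
    (hμ.const_mul _) (Filter.Eventually.of_forall fun v => ?_)
  · exact ((continuous_abs_inner_rpow hp).comp
      (Continuous.prodMk_left (y : E))).aestronglyMeasurable
  · refine Filter.Eventually.of_forall fun v => ?_
    rw [Real.norm_eq_abs, abs_of_nonneg (by positivity)]
    exact abs_inner_rpow_le hp hD v y.2
  · exact (continuous_abs_inner_rpow hp).comp (by fun_prop : Continuous fun y : K => (v, (y : E)))

variable {m : ℕ}

theorem continuous_deviation (hp : 0 ≤ p) (hD : K ⊆ Metric.closedBall 0 D)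
    (hμ : Integrable (fun v => ‖v‖ ^ p) μ) :
    Continuous fun z : (Fin m → E) × K =>
      |(1 / (m : ℝ)) * ∑ j, |inner ℝ (z.1 j) (z.2 : E)| ^ p
        - ∫ v, |inner ℝ v (z.2 : E)| ^ p ∂μ| :=
  continuous_abs.comp (((continuous_finsetSum _ fun j _ =>
    continuous_eval_abs_inner_rpow hp j).const_mul _).sub
      ((continuous_moment hp hD hμ).comp continuous_snd))

theorem bddAbove_range_deviation [CompactSpace K] (hp : 0 ≤ p) (hD : K ⊆ Metric.closedBall 0 D)
    (hμ : Integrable (fun v => ‖v‖ ^ p) μ) (a : Fin m → E) :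
    BddAbove (Set.range fun y : K => |(1 / (m : ℝ)) * ∑ j, |inner ℝ (a j) (y : E)| ^ p
        - ∫ v, |inner ℝ v (y : E)| ^ p ∂μ|) :=
  (isCompact_range ((continuous_deviation hp hD hμ).comp (Continuous.prodMk_right a))).bddAbove

theorem continuous_sampleDeviation [CompactSpace K] (hp : 0 ≤ p)
    (hD : K ⊆ Metric.closedBall 0 D) (hμ : Integrable (fun v => ‖v‖ ^ p) μ) :
    Continuous (sampleDeviation μ K p : (Fin m → E) → ℝ) :=
  continuous_iSup_of_compactSpace (continuous_deviation hp hD hμ)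

/-- Averaging over an independent copy `b` of the sample bounds the deviation from the mean by the
paired process. -/
theorem sampleDeviation_le [IsProbabilityMeasure μ] [CompactSpace K] [Nonempty K] (hm : 0 < m) (hp : 0 ≤ p) (hD : K ⊆ Metric.closedBall 0 D)
    (hμ : Integrable (fun v => ‖v‖ ^ p) μ) (a : Fin m → E)
    (hint : Integrable (fun b => pairedPowerSup K p (a, b)) (Measure.pi fun _ : Fin m => μ)) :
    sampleDeviation μ K p a
      ≤ 1 / m * ∫ b, pairedPowerSup K p (a, b) ∂(Measure.pi fun _ : Fin m => μ) := by
  set ν : Measure (Fin m → E) := Measure.pi fun _ => μ with hν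
  have hm0 : (0 : ℝ) < m := by exact_mod_cast hm
  refine ciSup_le fun y => ?_
  have hyint : Integrable (fun v => |inner ℝ v (y : E)| ^ p) μ := by
    refine (hμ.const_mul (D ^ p)).mono' ((continuous_abs_inner_rpow hp).comp
      (Continuous.prodMk_left (y : E))).aestronglyMeasurable
      (Filter.Eventually.of_forall fun v => ?_)
    rw [Real.norm_eq_abs, abs_of_nonneg (by positivity)]
    exact abs_inner_rpow_le hp hD v y.2
  have hj : ∀ j, Integrable (fun b : Fin m → E => |inner ℝ (b j) (y : E)| ^ p) ν := fun j =>
    (measurePreserving_eval (fun _ : Fin m => μ) j).integrable_comp_of_integrable hyint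
  have hjint : ∀ j, ∫ b : Fin m → E, |inner ℝ (b j) (y : E)| ^ p ∂ν
      = ∫ v, |inner ℝ v (y : E)| ^ p ∂μ := by
    intro j
    have hmp := measurePreserving_eval (fun _ : Fin m => μ) j
    conv_rhs => rw [← hmp.map_eq]
    rw [integral_map hmp.aemeasurable
      (by rw [hmp.map_eq]; exact hyint.aestronglyMeasurable)]
  have hsub : ∀ j, Integrable (fun b : Fin m → E =>
      |inner ℝ (a j) (y : E)| ^ p - |inner ℝ (b j) (y : E)| ^ p) ν := fun j =>
    (integrable_const _).sub (hj j)
  have hkey : ∫ b : Fin m → E, ∑ j, (|inner ℝ (a j) (y : E)| ^ p - |inner ℝ (b j) (y : E)| ^ p) ∂ν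
      = ∑ j, |inner ℝ (a j) (y : E)| ^ p - m * ∫ v, |inner ℝ v (y : E)| ^ p ∂μ := by
    rw [integral_finsetSum _ fun j _ => hsub j]
    have : ∀ j, ∫ b : Fin m → E, (|inner ℝ (a j) (y : E)| ^ p - |inner ℝ (b j) (y : E)| ^ p) ∂ν
        = |inner ℝ (a j) (y : E)| ^ p - ∫ v, |inner ℝ v (y : E)| ^ p ∂μ := by
      intro j
      rw [integral_sub (integrable_const _) (hj j), hjint j]
      simp
    rw [Finset.sum_congr rfl fun j _ => this j, Finset.sum_sub_distrib]
    simp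
  have h1 : (1 / (m : ℝ)) * ∑ j, |inner ℝ (a j) (y : E)| ^ p - ∫ v, |inner ℝ v (y : E)| ^ p ∂μ
      = 1 / m * ∫ b : Fin m → E, ∑ j,
        (|inner ℝ (a j) (y : E)| ^ p - |inner ℝ (b j) (y : E)| ^ p) ∂ν := by
    rw [hkey]
    field_simp
  rw [h1, abs_mul, abs_of_pos (show 0 < 1 / (m : ℝ) by positivity)]
  gcongr
  refine (abs_integral_le_integral_abs).trans
    (integral_mono (integrable_finsetSum _ fun j _ => hsub j).abs hint fun b => ?_)
  exact le_pairedPowerSup hp (a, b) y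

end Moments

/-! ### Symmetrization -/

section Symmetrization

variable {E : Type*} [NormedAddCommGroup E] [InnerProductSpace ℝ E] [FiniteDimensional ℝ E]
  [MeasurableSpace E] [BorelSpace E] {K : Set E} {p D : ℝ} {μ : Measure E}
  [IsProbabilityMeasure μ] {m : ℕ} [CompactSpace K] [Nonempty K]

theorem integrable_powerSup (hp : 0 ≤ p) (hD : K ⊆ Metric.closedBall 0 D)
    (hμ : Integrable (fun v => ‖v‖ ^ p) μ) :
    Integrable (powerSup K p : (Fin m → E) → ℝ) (Measure.pi fun _ => μ) := by
  refine ((integrable_sum_norm_rpow hμ).const_mul (D ^ p)).mono'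
    (continuous_powerSup hp).aestronglyMeasurable (Filter.Eventually.of_forall fun a => ?_)
  rw [Real.norm_eq_abs, abs_of_nonneg (powerSup_nonneg a)]
  exact powerSup_le hp hD a

theorem integrable_signedPowerSup (hp : 0 ≤ p) (hD : K ⊆ Metric.closedBall 0 D)
    (hμ : Integrable (fun v => ‖v‖ ^ p) μ) (ε : Fin m → Bool) :
    Integrable (signedPowerSup K p ε) (Measure.pi fun _ => μ) := by
  refine ((integrable_sum_norm_rpow hμ).const_mul (D ^ p)).mono'
    (continuous_signedPowerSup hp ε).aestronglyMeasurable (Filter.Eventually.of_forall fun a => ?_)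
  rw [Real.norm_eq_abs, abs_of_nonneg (signedPowerSup_nonneg ε a)]
  exact signedPowerSup_le hp hD ε a

theorem integrable_pairedPowerSup (hp : 0 ≤ p) (hD : K ⊆ Metric.closedBall 0 D)
    (hμ : Integrable (fun v => ‖v‖ ^ p) μ) :
    Integrable (pairedPowerSup K p : (Fin m → E) × (Fin m → E) → ℝ)
      ((Measure.pi fun _ => μ).prod (Measure.pi fun _ => μ)) := by
  have h := (integrable_sum_norm_rpow (m := m) hμ).const_mul (D ^ p)
  refine ((h.comp_fst _).add (h.comp_snd _)).mono'
    (continuous_pairedPowerSup hp).aestronglyMeasurable (Filter.Eventually.of_forall fun z => ?_)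
  rw [Real.norm_eq_abs, abs_of_nonneg (pairedPowerSup_nonneg z)]
  exact pairedPowerSup_le hp hD z

/-- Exchanging the two coordinates where `ε j` is false preserves the law of a pair of independent
samples, and turns the paired process into a sum of two signed processes. -/
theorem integral_pairedPowerSup_le (hp : 0 ≤ p) (hD : K ⊆ Metric.closedBall 0 D)
    (hμ : Integrable (fun v => ‖v‖ ^ p) μ) (ε : Fin m → Bool) :
    ∫ z, pairedPowerSup K p z ∂((Measure.pi fun _ : Fin m => μ).prod (Measure.pi fun _ => μ))
      ≤ 2 * ∫ a, signedPowerSup K p ε a ∂(Measure.pi fun _ => μ) := by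
  set ν : Measure (Fin m → E) := Measure.pi fun _ => μ with hν
  let e := MeasurableEquiv.arrowProdEquivProdArrow E E (Fin m)
  have he : MeasurePreserving e (Measure.pi fun _ => μ.prod μ) (ν.prod ν) :=
    measurePreserving_arrowProdEquivProdArrow E E (Fin m) (fun _ => μ) (fun _ => μ)
  let σ : (Fin m → E × E) → (Fin m → E × E) := fun z j => (if ε j then id else Prod.swap) (z j)
  have hσ : MeasurePreserving σ (Measure.pi fun _ => μ.prod μ) (Measure.pi fun _ => μ.prod μ) := by
    refine measurePreserving_pi (fun _ => μ.prod μ) (fun _ => μ.prod μ)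
      (f := fun j => if ε j then id else Prod.swap) fun j => ?_
    by_cases h : ε j
    · simp only [h, if_true]
      exact MeasurePreserving.id _
    · simp only [h, Bool.false_eq_true, if_false]
      exact Measure.measurePreserving_swap
  have hcomp := he.comp hσ
  have hG := continuous_pairedPowerSup (K := K) (m := m) hp
  have hFint := integrable_signedPowerSup (K := K) hp hD hμ ε
  have hadd : Integrable (fun z : (Fin m → E) × (Fin m → E) =>
      signedPowerSup K p ε z.1 + signedPowerSup K p ε z.2) (ν.prod ν) :=
    (hFint.comp_fst ν).add (hFint.comp_snd ν)
  calc ∫ z, pairedPowerSup K p z ∂(ν.prod ν)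
      = ∫ z, pairedPowerSup K p (e (σ z)) ∂(Measure.pi fun _ => μ.prod μ) := by
        rw [← hcomp.map_eq, integral_map hcomp.aemeasurable hG.aestronglyMeasurable]
        rfl
    _ ≤ ∫ z, (signedPowerSup K p ε (e z).1 + signedPowerSup K p ε (e z).2)
          ∂(Measure.pi fun _ => μ.prod μ) := by
        refine integral_mono (hcomp.integrable_comp_of_integrable
          (integrable_pairedPowerSup hp hD hμ)) (he.integrable_comp_of_integrable hadd)
          fun z => ciSup_le fun y => ?_
        have hterm : ∀ j, |inner ℝ ((e (σ z)).1 j) (y : E)| ^ p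
            - |inner ℝ ((e (σ z)).2 j) (y : E)| ^ p
            = boolSign (ε j) * |inner ℝ ((e z).1 j) (y : E)| ^ p
              - boolSign (ε j) * |inner ℝ ((e z).2 j) (y : E)| ^ p := by
          intro j
          change |inner ℝ ((if ε j then id else Prod.swap) (z j)).1 (y : E)| ^ p
            - |inner ℝ ((if ε j then id else Prod.swap) (z j)).2 (y : E)| ^ p
            = boolSign (ε j) * |inner ℝ (z j).1 (y : E)| ^ p
              - boolSign (ε j) * |inner ℝ (z j).2 (y : E)| ^ p
          by_cases h : ε j
          · simp [h, boolSign]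
          · simp [h, boolSign]
            ring
        simp only [hterm]
        rw [Finset.sum_sub_distrib]
        exact (abs_sub _ _).trans (add_le_add (le_signedPowerSup hp ε _ y)
          (le_signedPowerSup hp ε _ y))
    _ = ∫ z : (Fin m → E) × (Fin m → E), (signedPowerSup K p ε z.1 + signedPowerSup K p ε z.2)
          ∂(ν.prod ν) := by
        rw [← he.map_eq, integral_map he.aemeasurable]
        rw [he.map_eq]
        exact hadd.aestronglyMeasurable
    _ = _ := by
        rw [integral_add (hFint.comp_fst ν) (hFint.comp_snd ν),
          integral_fun_fst (fun a => signedPowerSup K p ε a),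
          integral_fun_snd (fun a => signedPowerSup K p ε a)]
        simp
        ring

end Symmetrization

/-! ### The deviation inequality -/

theorem le_sq_add_mul_sqrt_of_le_mul_sqrt {v A B : ℝ} (hA : 0 ≤ A) (hB : 0 ≤ B)
    (hv : 0 ≤ v) (h : v ≤ A * √(v + B)) : v ≤ A ^ 2 + A * √B := by
  by_contra! hcon
  have h1 := pow_le_pow_left₀ hv h 2
  rw [mul_pow, Real.sq_sqrt (by positivity)] at h1
  have hs := Real.sq_sqrt hB
  have hs0 := Real.sqrt_nonneg B
  have hAB : 0 ≤ A * √B := by positivity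
  have hv0 : 0 < v := lt_of_le_of_lt (by positivity) hcon
  have h2 : v * (v - A ^ 2) ≤ (A * √B) ^ 2 := by rw [mul_pow, hs]; linarith
  have h3 : v * (A * √B) < v * (v - A ^ 2) := mul_lt_mul_of_pos_left (by linarith) hv0
  have h4 : (A * √B) * (A * √B) ≤ v * (A * √B) := by
    gcongr
    linarith [sq_nonneg A]
  nlinarith

section Deviation

variable {E : Type*} [NormedAddCommGroup E] [InnerProductSpace ℝ E] [FiniteDimensional ℝ E]
  [MeasurableSpace E] [BorelSpace E] {K : Set E} {m : ℕ}

/-- The averaged form of `exists_rademacher_sup_bound`, with the optimal parameters of the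
sample `a`. -/
theorem sum_signedPowerSup_le {D p q q' lam : ℝ} (hm : 2 ≤ m) (hq : 2 ≤ q)
    (hqq : q.HolderConjugate q') (hqp : q ≤ p) (hlam : 0 < lam) (hK : IsSymmConvexBody K)
    (hconv : HasPowerTypeConvexity K q lam) (hD : K ⊆ Metric.closedBall 0 D) (a : Fin m → E) :
    ∑ ε, signedPowerSup K p ε a ≤ 2 ^ m * (16384 ^ p * lam ^ p * Real.log m ^ (1 / q') *
      (D ^ (p / 2) * (√(⨆ j, ‖a j‖ ^ p) * √(powerSup K p a)))) := by
  have : CompactSpace K := isCompact_iff_compactSpace.1 hK.isCompact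
  have : Nonempty K := ⟨⟨0, hK.zero_mem⟩⟩
  have hp : 2 ≤ p := hq.trans hqp
  have hD0 : 0 ≤ D := by simpa using hD hK.zero_mem
  set r : ℝ := ⨆ j, ‖a j‖ ^ p with hr
  have hr0 : 0 ≤ r := Real.iSup_nonneg fun j => by positivity
  have hx : ∀ j, ‖a j‖ ≤ r ^ (1 / p) := by
    intro j
    have h1 : ‖a j‖ ^ p ≤ r := le_ciSup (f := fun j => ‖a j‖ ^ p) (Set.finite_range _).bddAbove j
    have h2 := Real.rpow_le_rpow (by positivity) h1 (show 0 ≤ 1 / p by positivity)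
    rwa [← Real.rpow_mul (norm_nonneg _), mul_one_div_cancel (by linarith), Real.rpow_one] at h2
  obtain ⟨W, hW1, hW2⟩ := exists_rademacher_sup_bound hm hq hqq hqp hlam hK hconv hD hx
    (fun y hy => le_powerSup (by linarith) a ⟨y, hy⟩)
  have hsqrt : (D * r ^ (1 / p)) ^ (p / 2) = D ^ (p / 2) * √r := by
    rw [Real.mul_rpow hD0 (by positivity), ← Real.rpow_mul hr0, Real.sqrt_eq_rpow]
    congr 2
    field_simp
  rw [hsqrt, mul_assoc (D ^ (p / 2))] at hW1
  refine (Finset.sum_le_sum fun ε _ => ?_).trans hW1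
  exact ciSup_le fun y : K => hW2 ε y y.2

theorem integral_sampleDeviation_le {μ : Measure E} [IsProbabilityMeasure μ]
    {D B p q q' lam : ℝ} (hm : 2 ≤ m) (hq : 2 ≤ q) (hqq : q.HolderConjugate q') (hqp : q ≤ p)
    (hlam : 0 < lam) (hK : IsSymmConvexBody K) (hconv : HasPowerTypeConvexity K q lam)
    (hD : K ⊆ Metric.closedBall 0 D) (hμ : Integrable (fun v => ‖v‖ ^ p) μ)
    (hB : ∀ y ∈ K, ∫ v, |inner ℝ v y| ^ p ∂μ ≤ B) :
    Integrable (sampleDeviation μ K p) (Measure.pi fun _ : Fin m => μ) ∧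
    ∫ a, sampleDeviation μ K p a ∂(Measure.pi fun _ : Fin m => μ)
      ≤ 2 * (16384 ^ p * lam ^ p * Real.log m ^ (1 / q') * D ^ (p / 2)) / √m *
        √(∫ a, ⨆ j, ‖a j‖ ^ p ∂(Measure.pi fun _ : Fin m => μ)) *
        √(∫ a, sampleDeviation μ K p a ∂(Measure.pi fun _ : Fin m => μ) + B) := by
  have : CompactSpace K := isCompact_iff_compactSpace.1 hK.isCompact
  have : Nonempty K := ⟨⟨0, hK.zero_mem⟩⟩
  have hp : 2 ≤ p := hq.trans hqp
  have hp0 : 0 ≤ p := by linarith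
  have hm0 : (0 : ℝ) < m := by positivity
  have hD0 : 0 ≤ D := by simpa using hD hK.zero_mem
  set ν : Measure (Fin m → E) := Measure.pi fun _ => μ with hν
  set c := 16384 ^ p * lam ^ p * Real.log m ^ (1 / q') * D ^ (p / 2) with hc
  have hlogm : 0 ≤ Real.log m := Real.log_natCast_nonneg m
  have hc0 : 0 ≤ c := by positivity
  set V : (Fin m → E) → ℝ := sampleDeviation μ K p with hV
  have hV0 : ∀ a, 0 ≤ V a := fun a => Real.iSup_nonneg fun _ => abs_nonneg _
  have hGint := integrable_pairedPowerSup (m := m) (K := K) hp0 hD hμ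
  have hGsec : ∀ a : Fin m → E, Integrable (fun b => pairedPowerSup K p (a, b)) ν := by
    intro a
    have h := (integrable_sum_norm_rpow (m := m) hμ).const_mul (D ^ p)
    refine ((integrable_const (D ^ p * ∑ j, ‖a j‖ ^ p)).add h).mono'
      ((continuous_pairedPowerSup hp0).comp (Continuous.prodMk_right a)).aestronglyMeasurable
      (Filter.Eventually.of_forall fun b => ?_)
    rw [Real.norm_eq_abs, abs_of_nonneg (pairedPowerSup_nonneg _)]
    exact pairedPowerSup_le hp0 hD (a, b)
  have hVle : ∀ a, V a ≤ 1 / m * ∫ b, pairedPowerSup K p (a, b) ∂ν := fun a =>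
    sampleDeviation_le (by omega) hp0 hD hμ a (hGsec a)
  have hVint : Integrable V ν := by
    refine (hGint.integral_prod_left.const_mul (1 / m)).mono'
      (continuous_sampleDeviation hp0 hD hμ).aestronglyMeasurable
      (Filter.Eventually.of_forall fun a => ?_)
    rw [Real.norm_eq_abs, abs_of_nonneg (hV0 a)]
    exact hVle a
  refine ⟨hVint, ?_⟩
  set R : (Fin m → E) → ℝ := fun a => ⨆ j, ‖a j‖ ^ p with hR
  have hR0 : ∀ a, 0 ≤ R a := fun a => Real.iSup_nonneg fun j => by positivity
  have hRint : Integrable R ν := integrable_iSup_norm_rpow (by omega) hμ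
  have hSint : Integrable (powerSup K p) ν := integrable_powerSup hp0 hD hμ
  have hS0 : ∀ a : Fin m → E, 0 ≤ powerSup K p a := powerSup_nonneg
  -- symmetrization, averaged over the signs
  have h1 : ∫ a, V a ∂ν ≤ 1 / m * ∫ z, pairedPowerSup K p z ∂(ν.prod ν) := by
    rw [integral_prod _ hGint, ← integral_const_mul]
    exact integral_mono hVint (hGint.integral_prod_left.const_mul _) hVle
  have h2 : 2 ^ m * ∫ z, pairedPowerSup K p z ∂(ν.prod ν)
      ≤ 2 * ∫ a, ∑ ε, signedPowerSup K p ε a ∂ν := by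
    rw [integral_finsetSum _ fun ε _ => integrable_signedPowerSup hp0 hD hμ ε, Finset.mul_sum]
    have := Finset.sum_le_sum fun (ε : Fin m → Bool) (_ : ε ∈ Finset.univ) =>
      integral_pairedPowerSup_le (K := K) hp0 hD hμ ε
    simpa using this
  -- Cauchy-Schwarz
  have hsq : ∀ f : (Fin m → E) → ℝ, Integrable f ν → (∀ a, 0 ≤ f a) →
      MemLp (fun a => √(f a)) (ENNReal.ofReal 2) ν := by
    intro f hf hf0
    rw [show ENNReal.ofReal 2 = 2 by norm_num, memLp_two_iff_integrable_sq
      (Real.continuous_sqrt.comp_aestronglyMeasurable hf.aestronglyMeasurable)]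
    simpa only [Real.sq_sqrt (hf0 _)] using hf
  have hRL := hsq R hRint hR0
  have hSL := hsq _ hSint hS0
  have hCS := integral_mul_le_Lp_mul_Lq_of_nonneg (μ := ν) Real.HolderConjugate.two_two
    (Filter.Eventually.of_forall fun a => Real.sqrt_nonneg (R a))
    (Filter.Eventually.of_forall fun a => Real.sqrt_nonneg (powerSup K p a)) hRL hSL
  simp only [Real.rpow_ofNat, Real.sq_sqrt (hR0 _), Real.sq_sqrt (hS0 _),
    ← Real.sqrt_eq_rpow] at hCS
  have hRSint : Integrable (fun a => √(R a) * √(powerSup K p a)) ν := by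
    have e2 : ENNReal.ofReal 2 = 2 := by norm_num
    rw [e2] at hRL hSL
    exact hRL.integrable_mul hSL
  have h3 : ∫ a, ∑ ε, signedPowerSup K p ε a ∂ν
      ≤ 2 ^ m * (c * (√(∫ a, R a ∂ν) * √(∫ a, powerSup K p a ∂ν))) := by
    have hpt : ∀ a : Fin m → E, ∑ ε, signedPowerSup K p ε a
        ≤ 2 ^ m * c * (√(R a) * √(powerSup K p a)) := by
      intro a
      refine (sum_signedPowerSup_le hm hq hqq hqp hlam hK hconv hD a).trans (le_of_eq ?_)
      rw [hc]
      ring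
    calc _ ≤ ∫ a, 2 ^ m * c * (√(R a) * √(powerSup K p a)) ∂ν :=
          integral_mono (integrable_finsetSum _ fun ε _ => integrable_signedPowerSup hp0 hD hμ ε)
            (hRSint.const_mul _) hpt
      _ = 2 ^ m * c * ∫ a, √(R a) * √(powerSup K p a) ∂ν := integral_const_mul _ _
      _ ≤ 2 ^ m * c * (√(∫ a, R a ∂ν) * √(∫ a, powerSup K p a ∂ν)) := by gcongr
      _ = _ := by ring
  -- the empirical moments are controlled by the deviation itself
  have h4 : ∫ a, powerSup K p a ∂ν ≤ m * (∫ a, V a ∂ν + B) := by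
    have hpt : ∀ a : Fin m → E, powerSup K p a ≤ m * (V a + B) := by
      intro a
      refine ciSup_le fun y => ?_
      have e1 : |(1 / (m : ℝ)) * ∑ j, |inner ℝ (a j) (y : E)| ^ p
          - ∫ v, |inner ℝ v (y : E)| ^ p ∂μ| ≤ V a :=
        le_ciSup (bddAbove_range_deviation hp0 hD hμ a) y
      have e2 := (le_abs_self _).trans e1
      have e3 := hB y y.2
      calc ∑ j, |inner ℝ (a j) (y : E)| ^ p
          = m * ((1 / (m : ℝ)) * ∑ j, |inner ℝ (a j) (y : E)| ^ p) := by field_simp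
        _ ≤ _ := by
          gcongr
          linarith
    calc _ ≤ ∫ a, m * (V a + B) ∂ν :=
          integral_mono hSint ((hVint.add (integrable_const B)).const_mul _) hpt
      _ = _ := by
        rw [integral_const_mul, integral_add hVint (integrable_const B)]
        simp
  have h5 : ∫ z, pairedPowerSup K p z ∂(ν.prod ν)
      ≤ 2 * (c * (√(∫ a, R a ∂ν) * √(∫ a, powerSup K p a ∂ν))) := by
    have h2m : (0 : ℝ) < 2 ^ m := by positivity
    refine le_of_mul_le_mul_left ?_ h2m
    linarith
  calc ∫ a, V a ∂ν ≤ 1 / m * (2 * (c * (√(∫ a, R a ∂ν) * √(∫ a, powerSup K p a ∂ν)))) :=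
        h1.trans (by gcongr)
    _ ≤ 1 / m * (2 * (c * (√(∫ a, R a ∂ν) * √(m * (∫ a, V a ∂ν + B))))) := by gcongr
    _ = _ := by
      rw [Real.sqrt_mul hm0.le]
      have hmm : √(m : ℝ) * √m = m := Real.mul_self_sqrt hm0.le
      have hsm : 0 < √(m : ℝ) := Real.sqrt_pos.2 hm0
      rw [← hmm]
      simp only [Real.sqrt_mul_self hsm.le]
      field_simp

end Deviation

theorem theorem2 :
    ∃ C : ℝ, 0 < C ∧
      ∀ {E : Type*} [NormedAddCommGroup E] [InnerProductSpace ℝ E] [FiniteDimensional ℝ E]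
        [MeasurableSpace E] [BorelSpace E]
        {Ω : Type*} [MeasurableSpace Ω] (P : Measure Ω) [IsProbabilityMeasure P]
        (K : Set E) (D lam q q' p : ℝ) (m : ℕ) (X : Ω → E) (Xs : Fin m → Ω → E),
        IsSymmConvexBody K →
        IsRadius K D →
        2 ≤ q →
        q.HolderConjugate q' →
        0 < lam →
        HasPowerTypeConvexity K q lam →
        q ≤ p →
        2 ≤ m →
        iIndepFun Xs P →
        (∀ j, IdentDistrib (Xs j) X P P) →
        -- the exact moments are finite
        (∀ y ∈ K, Integrable (fun ω => |inner ℝ (X ω) y| ^ p) P) →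
        -- all suprema and expectations below are genuine finite ones
        Integrable (fun ω => ⨆ j, ‖Xs j ω‖ ^ p) P ∧
        BddAbove (Set.range fun y : K => exactMoment P X p (y : E)) ∧
        (∀ ω, BddAbove (Set.range fun y : K => momentDeviation P X Xs p ω (y : E))) ∧
        Integrable (maxMomentDeviation P K X Xs p) P ∧
        -- the deviation inequality
        ∫ ω, maxMomentDeviation P K X Xs p ω ∂P
          ≤ deviationA P Xs C lam D p q' ^ 2
            + deviationA P Xs C lam D p q' * Real.sqrt (momentB P K X p) ∧
        -- its consequence
        ∀ δ : ℝ, 0 ≤ δ → δ < 1 →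
          deviationA P Xs C lam D p q' ^ 2 ≤ δ ^ 2 * momentB P K X p →
          ∫ ω, maxMomentDeviation P K X Xs p ω ∂P ≤ 2 * δ * momentB P K X p
 := by
  refine ⟨32768, by norm_num, ?_⟩
  intro E _ _ _ _ _ Ω _ P _ K D lam q q' p m X Xs hK hDrad hq hqq hlam hconv hqp hm hindep hident
    hmom
  have hcompact : CompactSpace K := isCompact_iff_compactSpace.1 hK.isCompact
  have hne : Nonempty K := ⟨⟨0, hK.zero_mem⟩⟩
  have hp : 2 ≤ p := hq.trans hqp
  have hp0 : 0 ≤ p := by linarith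
  have hD : K ⊆ Metric.closedBall 0 D := hDrad.1
  have hD0 : 0 ≤ D := by simpa using hD hK.zero_mem
  have hm0 : (0 : ℝ) < m := by positivity
  have hlogm : 0 ≤ Real.log m := Real.log_natCast_nonneg m
  have hX : AEMeasurable X P := (hident ⟨0, by omega⟩).aemeasurable_snd
  have hXs : ∀ j, AEMeasurable (Xs j) P := fun j => (hident j).aemeasurable_fst
  -- transfer to the law `μ` of `X` and the law `ν` of the sample
  set μ : Measure E := P.map X with hμdef
  have hprob : IsProbabilityMeasure μ := Measure.isProbabilityMeasure_map hX
  set ν : Measure (Fin m → E) := Measure.pi fun _ => μ with hνdef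
  let S : Ω → Fin m → E := fun ω j => Xs j ω
  have hS : AEMeasurable S P := aemeasurable_pi_lambda _ hXs
  have hlaw : P.map S = ν := by
    have h := (iIndepFun_iff_map_fun_eq_pi_map hXs).1 hindep
    refine h.trans ?_
    rw [hνdef]
    congr 1
    funext j
    exact (hident j).map_eq
  have hexact : ∀ y, exactMoment P X p y = ∫ v, |inner ℝ v y| ^ p ∂μ := by
    intro y
    rw [exactMoment, hμdef, integral_map hX]
    exact ((continuous_abs_inner_rpow hp0).comp (Continuous.prodMk_left y)).aestronglyMeasurable
  have hμ : Integrable (fun v => ‖v‖ ^ p) μ := by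
    refine integrable_norm_rpow_of_inner (by linarith) hK.zero_mem_nhds fun y hy => ?_
    rw [hμdef, integrable_map_measure _ hX]
    · exact hmom y hy
    · exact ((continuous_abs_inner_rpow hp0).comp (Continuous.prodMk_left y)).aestronglyMeasurable
  have hdev : ∀ ω, maxMomentDeviation P K X Xs p ω = sampleDeviation μ K p (S ω) := by
    intro ω
    simp only [maxMomentDeviation, momentDeviation, sampleDeviation, hexact]
    rfl
  have hBbdd : BddAbove (Set.range fun y : K => exactMoment P X p (y : E)) := by
    simp only [hexact]
    exact (isCompact_range (continuous_moment hp0 hD hμ)).bddAbove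
  have hB : ∀ y ∈ K, ∫ v, |inner ℝ v y| ^ p ∂μ ≤ momentB P K X p := by
    intro y hy
    rw [← hexact]
    exact le_ciSup hBbdd ⟨y, hy⟩
  have hB0 : 0 ≤ momentB P K X p := by
    refine Real.iSup_nonneg fun y => integral_nonneg fun ω => ?_
    positivity
  have hRint : Integrable (fun a : Fin m → E => ⨆ j, ‖a j‖ ^ p) ν :=
    integrable_iSup_norm_rpow (by omega) hμ
  have hRint' : Integrable (fun ω => ⨆ j, ‖Xs j ω‖ ^ p) P := by
    rw [← hlaw] at hRint
    exact hRint.comp_aemeasurable hS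
  have hRval : ∫ ω, (⨆ j, ‖Xs j ω‖ ^ p) ∂P = ∫ a, ⨆ j, ‖a j‖ ^ p ∂ν := by
    rw [← hlaw, integral_map hS]
    rw [hlaw]
    exact hRint.aestronglyMeasurable
  obtain ⟨hVint, hVle⟩ := integral_sampleDeviation_le hm hq hqq hqp hlam hK hconv hD hμ hB
  have hVint' : Integrable (maxMomentDeviation P K X Xs p) P := by
    have h := hVint
    rw [← hνdef, ← hlaw] at h
    exact (h.comp_aemeasurable hS).congr (Filter.Eventually.of_forall fun ω => (hdev ω).symm)
  have hVval : ∫ ω, maxMomentDeviation P K X Xs p ω ∂P = ∫ a, sampleDeviation μ K p a ∂ν := by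
    simp only [hdev]
    rw [← hlaw, integral_map hS]
    rw [hlaw]
    exact hVint.aestronglyMeasurable
  rw [← hνdef, ← hVval, ← hRval] at hVle
  set v := ∫ ω, maxMomentDeviation P K X Xs p ω ∂P with hv
  set A := deviationA P Xs 32768 lam D p q' with hA
  have hv0 : 0 ≤ v := integral_nonneg fun ω => Real.iSup_nonneg fun y => abs_nonneg _
  have hκ0 : 0 ≤ ∫ ω, (⨆ j, ‖Xs j ω‖ ^ p) ∂P :=
    integral_nonneg fun ω => Real.iSup_nonneg fun j => by positivity
  have hA0 : 0 ≤ A := by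
    have : 0 ≤ kappa P Xs p := Real.rpow_nonneg hκ0 _
    rw [hA, deviationA]
    positivity
  have hcoef : 2 * (16384 ^ p * lam ^ p * Real.log m ^ (1 / q') * D ^ (p / 2)) / √m *
      √(∫ ω, (⨆ j, ‖Xs j ω‖ ^ p) ∂P) ≤ A := by
    have hk : (D * kappa P Xs p) ^ (p / 2) = D ^ (p / 2) * √(∫ ω, (⨆ j, ‖Xs j ω‖ ^ p) ∂P) := by
      rw [kappa, Real.mul_rpow hD0 (by positivity), ← Real.rpow_mul hκ0, Real.sqrt_eq_rpow]
      congr 2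
      field_simp
    have h2p : (2 : ℝ) ≤ 2 ^ p := by
      nth_rewrite 1 [← Real.rpow_one 2]
      exact Real.rpow_le_rpow_of_exponent_le (by norm_num) (by linarith)
    have hC : (32768 : ℝ) ^ p = 2 ^ p * 16384 ^ p := by
      rw [← Real.mul_rpow (by norm_num) (by norm_num)]
      norm_num
    rw [hA, deviationA, hk, hC]
    calc _ = 2 * 16384 ^ p * lam ^ p * (Real.log m ^ (1 / q') / √m) *
          (D ^ (p / 2) * √(∫ ω, (⨆ j, ‖Xs j ω‖ ^ p) ∂P)) := by ring
      _ ≤ _ := by gcongr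
  have hmain : v ≤ A ^ 2 + A * √(momentB P K X p) :=
    le_sq_add_mul_sqrt_of_le_mul_sqrt hA0 hB0 hv0 (hVle.trans (by gcongr))
  refine ⟨hRint', hBbdd, fun ω => ?_, hVint', hmain, fun δ hδ0 hδ1 hδ => ?_⟩
  · simp only [momentDeviation, hexact]
    exact bddAbove_range_deviation hp0 hD hμ (S ω)
  · have h1 : A ≤ δ * √(momentB P K X p) := by
      refine abs_le_of_sq_le_sq' ?_ (by positivity) |>.2
      rw [mul_pow, Real.sq_sqrt hB0]
      exact hδ
    have h2 : A * √(momentB P K X p) ≤ δ * momentB P K X p := by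
      calc _ ≤ δ * √(momentB P K X p) * √(momentB P K X p) := by gcongr
        _ = _ := by rw [mul_assoc, Real.mul_self_sqrt hB0]
    have h3 : δ ^ 2 * momentB P K X p ≤ δ * momentB P K X p := by
      gcongr
      nlinarith
    linarith
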